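/- Let $a,b>0$ with $a+b<1$, and let $p_1,p_2,\dots$ be independent random variables on a probability space $(\Omega,\mathcal P)$, each uniformly distributed on $[0,1]$. Starting from $I_\emptyset=[0,1]$, replace each interval $I$ of level $n-1$ by its left child (the left-most closed subinterval of length $a|I|$) and its right child (the right-most closed subinterval of length $b|I|$); the intersection over $n$ of the unions of the level $n$ intervals is the deterministic Moran set $C_{ab}$. Let $\mu_\omega$ be the random Borel probability measure on $C_{ab}$ for which, for every interval $I$ of level $n-1$, the left child of $I$ has measure $p_n(\omega)\mu_\omega(I)$ and the right child has measure $(1-p_n(\omega))\mu_\omega(I)$. A dimension function is a map $\Phi:(0,1)\to[0,\infty)$ such that $t^{1+\Phi(t)}$ decreases to $0$ as $t$ decreases to $0$. It is large if $\Phi(t)=H(t)\frac{\log|\log t|}{|\log t|}$ for all small $t$, with $H(t)\to\infty$ as $t\to0^+$. The upper $\Phi$-dimension of a measure $\mu$ is $$\overline{\dim}_\Phi\mu=\inf\Big\{d:\ (\exists C_1\in(0,1),\,C_2>0)(\forall\, 0<r<R^{1+\Phi(R)}\le R\le C_1)\ \ \tfrac{\mu(B(x,R))}{\mu(B(x,r))}\le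 C_2\big(\tfrac Rr\big)^d\ \ \forall x\in\operatorname{supp}\mu\Big\}.$$ For $\theta\ge0$ let $(Y(\theta),Z(\theta))=(\log p_1,\log a)$ if $p_1\le \frac{a^\theta}{a^\theta+b^\theta}$ and $(Y(\theta),Z(\theta))=(\log(1-p_1),\log b)$ otherwise, and put $G(\theta)=\mathbb E(Y(\theta))/\mathbb E(Z(\theta))$. Then the following hold. 1. For all $\theta\ge0$, $Y(\theta)$ and $Z(\theta)$ are integrable and $$G(\theta)=\frac{a^\theta\log\frac{a^\theta}{a^\theta+b^\theta}-a^\theta+b^\theta\log\frac{b^\theta}{a^\theta+b^\theta}-b^\theta}{a^\theta\log a+b^\theta\log b}.$$ 2. Write $a=b^\gamma$. For $\theta\ge0$, $G(\theta)=\theta$ if and only if $b^\theta+b^{\gamma\theta}=e^{-1}$. This last equation has exactly one real root $\theta=D_{ab}$; it is positive, and almost surely $\overline{\dim}_\Phi\mu_\omega=D_{ab}$ for all large dimension functions $\Phi$. 3. As $(a,b)$ varies over $\{a,b>0,\ a+b<1\}$, $D_{ab}\to0$ as $a$ and $b$ both tend to $0$, and $D_{ab}\to\infty$ as $a\to1$,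 and also as $b\to1$. -/

import Mathlib

open MeasureTheory ProbabilityTheory Filter Topology Set

/-! ### Dimension functions and upper dimensions of measures -/

/-- A dimension function: a map `Φ : (0,1) → [0,∞)` such that `t ^ (1 + Φ t)` decreases to `0`
as `t` decreases to `0`. Values of `Φ` outside `(0,1)` are irrelevant. -/
def IsDimensionFunction (Φ : ℝ → ℝ) : Prop :=
  (∀ t ∈ Ioo (0 : ℝ) 1, 0 ≤ Φ t) ∧
  MonotoneOn (fun t : ℝ => t ^ (1 + Φ t)) (Ioo 0 1) ∧
  Tendsto (fun t : ℝ => t ^ (1 + Φ t)) (𝓝[>] 0) (𝓝 0)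

/-- `Φ` is large: `Φ t = H t * (log |log t| / |log t|)` near `0`, where `H t → ∞` as `t → 0+`. -/
def IsLargeDimensionFunction (Φ : ℝ → ℝ) : Prop :=
  IsDimensionFunction Φ ∧
  ∃ H : ℝ → ℝ, Tendsto H (𝓝[>] 0) atTop ∧
    ∀ᶠ t in 𝓝[>] (0 : ℝ), Φ t = H t * (Real.log |Real.log t| / |Real.log t|)

/-- The upper `Φ`-dimension of a measure `μ` on a metric space, as an extended real number
(the infimum of the empty set is `∞`). -/
noncomputable def upperPhiDim {X : Type*} [PseudoMetricSpace X] [MeasurableSpace X]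
    (Φ : ℝ → ℝ) (μ : Measure X) : EReal :=
  sInf (((↑) : ℝ → EReal) '' {d : ℝ |
    ∃ C₁ C₂ : ℝ, 0 < C₁ ∧ C₁ < 1 ∧ 0 < C₂ ∧
      ∀ r R : ℝ, 0 < r → r < R ^ (1 + Φ R) → R ^ (1 + Φ R) ≤ R → R ≤ C₁ →
        ∀ x ∈ μ.support,
          μ (Metric.ball x R) / μ (Metric.ball x r) ≤ ENNReal.ofReal (C₂ * (R / r) ^ d)})

/-! ### Moran sets and Moran measures on the line

A path in the binary tree is a sequence `v : ℕ → Bool`; `v n = false` selects the left child and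
`v n = true` the right child when passing from level `n` to level `n + 1`. The ratios and the
probability used in that passage are `a n`, `b n` and `p n`. -/

/-- Left endpoint and length of the level `n` Moran interval along the path `v`. -/
noncomputable def moranInterval (a b : ℕ → ℝ) (v : ℕ → Bool) : ℕ → ℝ × ℝ
  | 0 => (0, 1)
  | n + 1 =>
    if v n then
      ((moranInterval a b v n).1 + (moranInterval a b v n).2 - b n * (moranInterval a b v n).2,
        b n * (moranInterval a b v n).2)
    else
      ((moranInterval a b v n).1, a n * (moranInterval a b v n).2)

/-- The level `n` Moran interval along the path `v`, as a closed interval. -/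
def moranCell (a b : ℕ → ℝ) (v : ℕ → Bool) (n : ℕ) : Set ℝ :=
  Icc (moranInterval a b v n).1 ((moranInterval a b v n).1 + (moranInterval a b v n).2)

/-- The point of the Moran set coded by the path `v`: the limit of the (nondecreasing) left
endpoints of the Moran intervals along `v`. -/
noncomputable def moranPoint (a b : ℕ → ℝ) (v : ℕ → Bool) : ℝ :=
  ⨆ n, (moranInterval a b v n).1

/-- The Moran measure with ratios `a n`, `b n` and probabilities `p n`: at level `n + 1` the left
child receives the proportion `p n` of the mass of its parent and the right child the proportion
`1 - p n`. It is the image under the coding map of the product of the measures on `Bool` that give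
mass `p n` to `false` and `1 - p n` to `true`. -/
noncomputable def moranMeasure (a b : ℕ → ℝ) (p : ℕ → unitInterval) : Measure ℝ :=
  (Measure.infinitePi fun n => bernoulliMeasure false true (p n)).map (moranPoint a b)

/-! ### The functions `Y`, `Z` and `G` -/

/-- The value of `Y(θ)` when the ratios are `a`, `b` and the probability is `p`. -/
noncomputable def branchLogProb (a b p θ : ℝ) : ℝ :=
  if p ≤ a ^ θ / (a ^ θ + b ^ θ) then Real.log p else Real.log (1 - p)

/-- The value of `Z(θ)` when the ratios are `a`, `b` and the probability is `p`. -/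
noncomputable def branchLogRatio (a b p θ : ℝ) : ℝ :=
  if p ≤ a ^ θ / (a ^ θ + b ^ θ) then Real.log a else Real.log b

/-- `G(θ) = E[Y(θ)] / E[Z(θ)]`. -/
noncomputable def branchG {Ω : Type*} [MeasurableSpace Ω] (P : Measure Ω) (a b p : Ω → ℝ)
    (θ : ℝ) : ℝ :=
  (∫ ω, branchLogProb (a ω) (b ω) (p ω) θ ∂P) / ∫ ω, branchLogRatio (a ω) (b ω) (p ω) θ ∂P

/-! ### The Moran measure has the prescribed masses -/

lemma moranInterval_congr (a b : ℕ → ℝ) {v w : ℕ → Bool} {n : ℕ} (h : ∀ i < n, v i = w i) :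
    moranInterval a b v n = moranInterval a b w n := by
  induction n with
  | zero => rfl
  | succ n ih =>
    simp only [moranInterval, ih fun i hi => h i (by omega), h n (by omega)]

lemma moranInterval_bounds {a b : ℕ → ℝ} (ha : ∀ n, 0 < a n) (hb : ∀ n, 0 < b n)
    (hab : ∀ n, a n + b n < 1) (v : ℕ → Bool) (n : ℕ) :
    0 < (moranInterval a b v n).2 ∧
    (moranInterval a b v n).1 ≤ (moranInterval a b v (n + 1)).1 ∧
    (moranInterval a b v (n + 1)).1 + (moranInterval a b v (n + 1)).2 ≤
      (moranInterval a b v n).1 + (moranInterval a b v n).2 := by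
  have hpos : ∀ n, 0 < (moranInterval a b v n).2 := by
    intro n
    induction n with
    | zero => simp [moranInterval]
    | succ n ih =>
      have := mul_pos (ha n) ih
      have := mul_pos (hb n) ih
      by_cases h : v n <;> simpa [moranInterval, h]
  have h0 := hpos n
  have h1 := mul_pos (ha n) h0
  have h2 := mul_pos (hb n) h0
  have h3 := mul_lt_mul_of_pos_right (hab n) h0
  refine ⟨h0, ?_⟩
  by_cases h : v n <;> simp only [moranInterval, h] <;> constructor <;> simp <;> nlinarith

lemma moranPoint_mem {a b : ℕ → ℝ} (ha : ∀ n, 0 < a n) (hb : ∀ n, 0 < b n)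
    (hab : ∀ n, a n + b n < 1) (v : ℕ → Bool) (n : ℕ) :
    moranPoint a b v ∈ moranCell a b v n := by
  have hB := moranInterval_bounds ha hb hab v
  have hmono : Monotone fun n => (moranInterval a b v n).1 :=
    monotone_nat_of_le_succ fun n => (hB n).2.1
  have hanti : Antitone fun n => (moranInterval a b v n).1 + (moranInterval a b v n).2 :=
    antitone_nat_of_succ_le fun n => (hB n).2.2
  have hle : ∀ m, (moranInterval a b v m).1 ≤
      (moranInterval a b v n).1 + (moranInterval a b v n).2 := by
    intro m
    have h1 : (moranInterval a b v m).1 ≤ (moranInterval a b v (max m n)).1 :=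
      hmono (le_max_left m n)
    have h2 : (moranInterval a b v (max m n)).1 + (moranInterval a b v (max m n)).2 ≤
      (moranInterval a b v n).1 + (moranInterval a b v n).2 := hanti (le_max_right m n)
    linarith [(hB (max m n)).1]
  exact ⟨le_ciSup (f := fun m => (moranInterval a b v m).1) ⟨_, forall_mem_range.2 hle⟩ n,
    ciSup_le hle⟩

lemma moranPoint_mem_iff {a b : ℕ → ℝ} (ha : ∀ n, 0 < a n) (hb : ∀ n, 0 < b n)
    (hab : ∀ n, a n + b n < 1) (v w : ℕ → Bool) (n : ℕ) :
    moranPoint a b w ∈ moranCell a b v n ↔ ∀ i < n, w i = v i := by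
  constructor
  · induction n with
    | zero => simp
    | succ n ih =>
      intro h
      have hB := moranInterval_bounds ha hb hab v n
      have hprev : ∀ i < n, w i = v i := ih ⟨hB.2.1.trans h.1, h.2.trans hB.2.2⟩
      have hw := moranPoint_mem ha hb hab w (n + 1)
      have heq := moranInterval_congr a b hprev
      have h3 : a n * (moranInterval a b v n).2 + b n * (moranInterval a b v n).2 <
          (moranInterval a b v n).2 := by nlinarith [mul_lt_mul_of_pos_right (hab n) hB.1]
      clear ih hab
      intro i hi
      rcases Nat.lt_succ_iff_lt_or_eq.1 hi with hi | rfl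
      · exact hprev i hi
      · unfold moranCell at h hw
        by_contra hne
        cases hv : v i <;> cases hw' : w i <;>
          simp [moranInterval, heq, hv, hw'] at h hw hne <;> linarith [h.1, h.2, hw.1, hw.2]
  · intro h
    have := moranPoint_mem ha hb hab w n
    rwa [moranCell, moranInterval_congr a b h] at this

lemma measurable_moranPoint (a b : ℕ → ℝ) : Measurable (moranPoint a b) := by
  refine Measurable.iSup fun n => ?_
  suffices h : Measurable fun v => moranInterval a b v n from h.fst
  induction n with
  | zero => exact measurable_const
  | succ n ih =>
    simp only [moranInterval]
    refine Measurable.ite (measurableSet_eq_fun (measurable_pi_apply n) measurable_const) ?_ ?_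
    · fun_prop
    · fun_prop

/-- The Moran measure gives every Moran interval the product of the probabilities along the path
that leads to it; in particular `[0,1]` has mass `1`. -/
lemma moranMeasure_moranCell {a b : ℕ → ℝ} (ha : ∀ n, 0 < a n) (hb : ∀ n, 0 < b n)
    (hab : ∀ n, a n + b n < 1) (p : ℕ → unitInterval) (v : ℕ → Bool) (n : ℕ) :
    moranMeasure a b p (moranCell a b v n) =
      ∏ i ∈ Finset.range n, ENNReal.ofReal (if v i then 1 - (p i : ℝ) else p i) := by
  rw [moranMeasure, Measure.map_apply (measurable_moranPoint a b) (by exact measurableSet_Icc)]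
  have : moranPoint a b ⁻¹' moranCell a b v n =
      Set.pi (Finset.range n : Set ℕ) fun i => {v i} := by
    ext w
    simp [moranPoint_mem_iff ha hb hab]
  rw [this, Measure.infinitePi_pi _ fun _ _ => measurableSet_singleton _]
  refine Finset.prod_congr rfl fun i _ => ?_
  classical
  rw [bernoulliMeasure_apply _ (measurableSet_singleton _)]
  have h1 : ENNReal.ofReal (p i) = (unitInterval.toNNReal (p i) : ENNReal) := by
    rw [ENNReal.ofReal, Real.toNNReal_of_nonneg (p i).2.1]; rfl
  have h2 : ENNReal.ofReal (1 - p i) =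
      (unitInterval.toNNReal (unitInterval.symm (p i)) : ENNReal) := by
    rw [ENNReal.ofReal, Real.toNNReal_of_nonneg (sub_nonneg.2 (p i).2.2)]; rfl
  cases v i <;> simp [h1, h2]
/-!
For `0 < x < 1` let `W = max (a ^ d / x, b ^ d / (1 - x))`. Then `(a ^ d + b ^ d) / W` is the skew
tent map with peak at `a ^ d / (a ^ d + b ^ d)` evaluated at `x`. Skew tent maps preserve Lebesgue
measure, so for a uniform `x` the variable `log W` is `log (a ^ d + b ^ d)` plus a standard
exponential variable. Its mean is `log (a ^ d + b ^ d) + 1`, which is positive for `d < D_{ab}` and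
negative for `d > D_{ab}`; moreover `Y = d Z - log W`, which gives the formula for `G`.

The gap `1 - a - b` allows balls to be compared with Moran intervals. Between levels `n` and
`n + k`, the length ratio to the power `d` divided by the mass ratio is at most the product of the
`k` corresponding values of `W`, with equality along the path that always follows the larger term.
If `d < D_{ab}` these products tend to infinity by the strong law of large numbers, so along that
path the mass of small balls is much smaller than the power `d` of their radii. If `d > D_{ab}`, a
Chernoff bound shows that a product of `k` factors exceeds `1` with probability exponentially small
in `k`, and by Borel–Cantelli this eventually does not happen for `k ≥ A log n`. For a large
dimension function the ratio `R / r` forces `k` to exceed every multiple of `log n`.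
-/

/-! ### Products along a path -/

/-- The product of the first `n` factors along the path `v`, where the factor of level `i` is `x i`
on the left and `y i` on the right. It is the length of a Moran interval when `x` and `y` are the
ratios, and the mass of a Moran interval when they are the branch probabilities. -/
noncomputable def pathProd (x y : ℕ → ℝ) (v : ℕ → Bool) (n : ℕ) : ℝ :=
  ∏ i ∈ Finset.range n, if v i then y i else x i

section PathProd

variable {x y : ℕ → ℝ} {c : ℝ}

lemma pathProd_zero (x y : ℕ → ℝ) (v : ℕ → Bool) : pathProd x y v 0 = 1 :=
  Finset.prod_range_zero _

lemma pathProd_succ (x y : ℕ → ℝ) (v : ℕ → Bool) (n : ℕ) :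
    pathProd x y v (n + 1) = pathProd x y v n * if v n then y n else x n :=
  Finset.prod_range_succ _ n

lemma pathProd_add (x y : ℕ → ℝ) (v : ℕ → Bool) (n k : ℕ) :
    pathProd x y v (n + k) = pathProd x y v n *
      pathProd (fun i => x (n + i)) (fun i => y (n + i)) (fun i => v (n + i)) k :=
  Finset.prod_range_add _ n k

lemma pathProd_pos (hx : ∀ i, 0 < x i) (hy : ∀ i, 0 < y i) (v : ℕ → Bool) (n : ℕ) :
    0 < pathProd x y v n :=
  Finset.prod_pos fun i _ => by split_ifs <;> simp only [hx, hy]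

lemma pathProd_one_sub_pos (hx : ∀ i, x i ∈ Ioo (0 : ℝ) 1) (v : ℕ → Bool) (n : ℕ) :
    0 < pathProd x (fun i => 1 - x i) v n :=
  pathProd_pos (fun i => (hx i).1) (fun i => sub_pos.2 (hx i).2) v n

lemma pow_le_pathProd (hc : 0 ≤ c) (hx : ∀ i, c ≤ x i) (hy : ∀ i, c ≤ y i) (v : ℕ → Bool)
    (n : ℕ) : c ^ n ≤ pathProd x y v n := by
  calc c ^ n = ∏ _i ∈ Finset.range n, c := by simp only [Finset.prod_const, Finset.card_range]
    _ ≤ pathProd x y v n := Finset.prod_le_prod (fun _ _ => hc) fun i _ => by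
      split_ifs <;> simp only [hx, hy]

lemma pathProd_le_pow (hx₀ : ∀ i, 0 ≤ x i) (hy₀ : ∀ i, 0 ≤ y i) (hx : ∀ i, x i ≤ c)
    (hy : ∀ i, y i ≤ c) (v : ℕ → Bool) (n : ℕ) : pathProd x y v n ≤ c ^ n := by
  calc pathProd x y v n ≤ ∏ _i ∈ Finset.range n, c :=
      Finset.prod_le_prod (fun i _ => by split_ifs <;> simp only [hx₀, hy₀])
        fun i _ => by split_ifs <;> simp only [hx, hy]
    _ = c ^ n := by simp only [Finset.prod_const, Finset.card_range]

lemma moranInterval_snd (a b : ℕ → ℝ) (v : ℕ → Bool) (n : ℕ) :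
    (moranInterval a b v n).2 = pathProd a b v n := by
  induction n with
  | zero => rfl
  | succ n ih => cases h : v n <;> simp [moranInterval, pathProd_succ, h, ih, mul_comm]

lemma moranMeasure_moranCell_eq_pathProd {a b : ℕ → ℝ} (ha : ∀ n, 0 < a n) (hb : ∀ n, 0 < b n)
    (hab : ∀ n, a n + b n < 1) (p : ℕ → unitInterval) (v : ℕ → Bool) (n : ℕ) :
    moranMeasure a b p (moranCell a b v n) =
      ENNReal.ofReal (pathProd (fun i => p i) (fun i => 1 - p i) v n) := by
  rw [moranMeasure_moranCell ha hb hab, pathProd, ENNReal.ofReal_prod_of_nonneg]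
  intro i _
  split_ifs
  exacts [sub_nonneg.2 (p i).2.2, (p i).2.1]

end PathProd

instance (a b : ℕ → ℝ) (p : ℕ → unitInterval) : IsProbabilityMeasure (moranMeasure a b p) :=
  Measure.isProbabilityMeasure_map (measurable_moranPoint a b).aemeasurable

lemma exists_moranPoint_dist_lt {a b : ℕ → ℝ} {p : ℕ → unitInterval} {x r : ℝ}
    (hx : x ∈ (moranMeasure a b p).support) (hr : 0 < r) :
    ∃ v, dist (moranPoint a b v) x < r := by
  have h := (Measure.mem_support_iff_forall x).1 hx _ (Metric.ball_mem_nhds x hr)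
  rw [moranMeasure, Measure.map_apply (measurable_moranPoint a b) measurableSet_ball] at h
  exact nonempty_of_measure_ne_zero h.ne'

/-! ### Balls and Moran intervals -/

/-- Uniform bounds on the ratios of a Moran construction: all children have relative length at
least `c`, and siblings are separated by a relative gap of at least `τ`. -/
structure MoranRatioBounds (a b : ℕ → ℝ) (c τ : ℝ) : Prop where
  pos : 0 < c
  gap_pos : 0 < τ
  le_left : ∀ n, c ≤ a n
  le_right : ∀ n, c ≤ b n
  add_add_le_one : ∀ n, a n + b n + τ ≤ 1

namespace MoranRatioBounds

variable {a b : ℕ → ℝ} {c τ : ℝ} {p : ℕ → unitInterval}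

lemma left_pos (h : MoranRatioBounds a b c τ) (n : ℕ) : 0 < a n :=
  h.pos.trans_le (h.le_left n)

lemma right_pos (h : MoranRatioBounds a b c τ) (n : ℕ) : 0 < b n :=
  h.pos.trans_le (h.le_right n)

lemma add_lt_one (h : MoranRatioBounds a b c τ) (n : ℕ) : a n + b n < 1 := by
  linarith [h.add_add_le_one n, h.gap_pos]

lemma left_le (h : MoranRatioBounds a b c τ) (n : ℕ) : a n ≤ 1 - τ := by
  linarith [h.add_add_le_one n, h.right_pos n]

lemma right_le (h : MoranRatioBounds a b c τ) (n : ℕ) : b n ≤ 1 - τ := by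
  linarith [h.add_add_le_one n, h.left_pos n]

lemma gap_lt_one (h : MoranRatioBounds a b c τ) : τ < 1 := by
  linarith [h.left_le 0, h.left_pos 0]

lemma lt_one (h : MoranRatioBounds a b c τ) : c < 1 := by
  linarith [h.le_left 0, h.left_le 0, h.gap_pos]

lemma shift (h : MoranRatioBounds a b c τ) (n : ℕ) :
    MoranRatioBounds (fun i => a (n + i)) (fun i => b (n + i)) c τ :=
  ⟨h.pos, h.gap_pos, fun _ => h.le_left _, fun _ => h.le_right _, fun _ => h.add_add_le_one _⟩

protected lemma pathProd_pos (h : MoranRatioBounds a b c τ) (v : ℕ → Bool) (n : ℕ) :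
    0 < pathProd a b v n :=
  pathProd_pos h.left_pos h.right_pos v n

protected lemma pow_le_pathProd (h : MoranRatioBounds a b c τ) (v : ℕ → Bool) (n : ℕ) :
    c ^ n ≤ pathProd a b v n :=
  pow_le_pathProd h.pos.le h.le_left h.le_right v n

protected lemma pathProd_le_pow (h : MoranRatioBounds a b c τ) (v : ℕ → Bool) (n : ℕ) :
    pathProd a b v n ≤ (1 - τ) ^ n :=
  pathProd_le_pow (fun i => (h.left_pos i).le) (fun i => (h.right_pos i).le) h.left_le
    h.right_le v n

lemma pow_mul_pathProd_le (h : MoranRatioBounds a b c τ) (v : ℕ → Bool) (n k : ℕ) :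
    c ^ k * pathProd a b v n ≤ pathProd a b v (n + k) := by
  rw [pathProd_add, mul_comm]
  exact mul_le_mul_of_nonneg_left ((h.shift n).pow_le_pathProd _ k) (h.pathProd_pos v n).le

lemma antitone_pathProd (h : MoranRatioBounds a b c τ) (v : ℕ → Bool) :
    Antitone (pathProd a b v) := by
  refine antitone_nat_of_succ_le fun n => ?_
  rw [pathProd_succ]
  refine mul_le_of_le_one_right (h.pathProd_pos v n).le ?_
  split_ifs
  · linarith [h.right_le n, h.gap_pos]
  · linarith [h.left_le n, h.gap_pos]

lemma tendsto_pathProd (h : MoranRatioBounds a b c τ) (v : ℕ → Bool) :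
    Tendsto (pathProd a b v) atTop (𝓝 0) :=
  squeeze_zero (fun n => (h.pathProd_pos v n).le) (h.pathProd_le_pow v)
    (tendsto_pow_atTop_nhds_zero_of_lt_one (by linarith [h.gap_lt_one]) (by linarith [h.gap_pos]))

lemma exists_pathProd_mem_Ico (h : MoranRatioBounds a b c τ) (v : ℕ → Bool) {t : ℝ} (ht : 0 < t)
    (ht₁ : t ≤ 1) : ∃ n, pathProd a b v n ∈ Ico (c * t) t := by
  classical
  have hex : ∃ n, pathProd a b v n < t := ((h.tendsto_pathProd v).eventually_lt_const ht).exists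
  obtain ⟨m, hm⟩ : ∃ m, Nat.find hex = m + 1 := by
    refine Nat.exists_eq_succ_of_ne_zero fun h₀ => ?_
    exact ((Nat.find_eq_zero hex).1 h₀).not_ge ((pathProd_zero a b v).symm ▸ ht₁)
  have hlt : pathProd a b v (m + 1) < t := hm ▸ Nat.find_spec hex
  have hle : t ≤ pathProd a b v m := not_lt.1 (Nat.find_min hex (by omega))
  refine ⟨m + 1, ?_, hlt⟩
  calc c * t ≤ c * pathProd a b v m := mul_le_mul_of_nonneg_left hle h.pos.le
    _ ≤ pathProd a b v (m + 1) := by simpa using h.pow_mul_pathProd_le v m 1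

lemma mul_pathProd_le_dist_moranPoint (h : MoranRatioBounds a b c τ) {v w : ℕ → Bool} {j : ℕ}
    (hvw : ∀ i < j, w i = v i) (hj : w j ≠ v j) :
    τ * pathProd a b v j ≤ dist (moranPoint a b w) (moranPoint a b v) := by
  have hv := moranPoint_mem h.left_pos h.right_pos h.add_lt_one v (j + 1)
  have hw := moranPoint_mem h.left_pos h.right_pos h.add_lt_one w (j + 1)
  have hgap : (a j + b j + τ) * pathProd a b v j ≤ 1 * pathProd a b v j :=
    mul_le_mul_of_nonneg_right (h.add_add_le_one j) (h.pathProd_pos v j).le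
  rw [← moranInterval_snd] at hgap ⊢
  rw [Real.dist_eq]
  cases hv' : v j <;> cases hw' : w j <;>
    simp only [moranCell, moranInterval, moranInterval_congr a b hvw, hv', hw', mem_Icc, ne_eq,
      if_true, Bool.false_eq_true, if_false, not_true] at hv hw hj
  · exact le_trans (by linarith) (le_abs_self _)
  · exact le_trans (by linarith) (neg_le_abs _)

lemma eq_of_dist_moranPoint_lt (h : MoranRatioBounds a b c τ) {v w : ℕ → Bool} {n : ℕ}
    (hd : dist (moranPoint a b w) (moranPoint a b v) < τ * pathProd a b v n) :
    ∀ i < n, w i = v i := by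
  intro j
  induction j using Nat.strong_induction_on with
  | _ j ih =>
    intro hj
    by_contra hne
    have hagree : ∀ i < j, w i = v i := fun i hi => ih i hi (hi.trans hj)
    have hlen : τ * pathProd a b v n ≤ τ * pathProd a b v j :=
      mul_le_mul_of_nonneg_left (h.antitone_pathProd v hj.le) h.gap_pos.le
    exact (hd.trans_le hlen).not_ge (h.mul_pathProd_le_dist_moranPoint hagree hne)

lemma moranMeasure_ball_le (h : MoranRatioBounds a b c τ) (v : ℕ → Bool) {n : ℕ} {R : ℝ}
    (hR : R ≤ τ * pathProd a b v n) :
    moranMeasure a b p (Metric.ball (moranPoint a b v) R) ≤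
      ENNReal.ofReal (pathProd (fun i => p i) (fun i => 1 - p i) v n) := by
  rw [← moranMeasure_moranCell_eq_pathProd h.left_pos h.right_pos h.add_lt_one, moranMeasure,
    Measure.map_apply (measurable_moranPoint a b) measurableSet_ball,
    Measure.map_apply (measurable_moranPoint a b) (by exact measurableSet_Icc)]
  refine measure_mono fun w hw => ?_
  exact (moranPoint_mem_iff h.left_pos h.right_pos h.add_lt_one v w n).2
    (h.eq_of_dist_moranPoint_lt (hw.trans_le hR))

lemma le_moranMeasure_ball (h : MoranRatioBounds a b c τ) (v : ℕ → Bool) {n : ℕ} {r : ℝ}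
    (hr : pathProd a b v n < r) :
    ENNReal.ofReal (pathProd (fun i => p i) (fun i => 1 - p i) v n) ≤
      moranMeasure a b p (Metric.ball (moranPoint a b v) r) := by
  rw [← moranMeasure_moranCell_eq_pathProd h.left_pos h.right_pos h.add_lt_one]
  refine measure_mono fun x hx => ?_
  have hv := moranPoint_mem h.left_pos h.right_pos h.add_lt_one v n
  have hdist := Real.dist_le_of_mem_Icc hx hv
  rw [add_sub_cancel_left, moranInterval_snd] at hdist
  exact hdist.trans_lt hr

lemma moranPoint_mem_support (h : MoranRatioBounds a b c τ)
    (hp : ∀ n, (p n : ℝ) ∈ Ioo (0 : ℝ) 1) (v : ℕ → Bool) :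
    moranPoint a b v ∈ (moranMeasure a b p).support := by
  refine (Measure.mem_support_iff_forall _).2 fun U hU => ?_
  obtain ⟨r, hr, hrU⟩ := Metric.mem_nhds_iff.1 hU
  obtain ⟨n, hn⟩ := ((h.tendsto_pathProd v).eventually_lt_const hr).exists
  calc 0 < ENNReal.ofReal (pathProd (fun i => p i) (fun i => 1 - p i) v n) :=
        ENNReal.ofReal_pos.2 (pathProd_one_sub_pos hp v n)
    _ ≤ moranMeasure a b p (Metric.ball (moranPoint a b v) r) := h.le_moranMeasure_ball v hn
    _ ≤ moranMeasure a b p U := measure_mono hrU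

/-- A ball of radius `R` meets only one Moran interval of length about `2 * R / (c * τ)`, and a ball
of radius `r` contains one of length about `r / 2`. -/
lemma exists_moranMeasure_ball_div_le (h : MoranRatioBounds a b c τ)
    (hp : ∀ n, (p n : ℝ) ∈ Ioo (0 : ℝ) 1) {x r R : ℝ} (hx : x ∈ (moranMeasure a b p).support)
    (hr : 0 < r) (hrR : r ≤ R) (hR : 2 * R ≤ c * τ) :
    ∃ v N k, pathProd a b v N ∈ Ico (2 * R / τ) (2 * R / (c * τ)) ∧
      pathProd a b v (N + k) ∈ Ico (c * (r / 2)) (r / 2) ∧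
      moranMeasure a b p (Metric.ball x R) / moranMeasure a b p (Metric.ball x r) ≤
        ENNReal.ofReal (pathProd (fun i => p i) (fun i => 1 - p i) v N /
          pathProd (fun i => p i) (fun i => 1 - p i) v (N + k)) := by
  have hc := h.pos
  have hτ := h.gap_pos
  have hcτ : c * τ < 1 := by nlinarith [h.lt_one, h.gap_lt_one]
  have hR₀ : 0 < R := hr.trans_le hrR
  obtain ⟨v, hv⟩ := exists_moranPoint_dist_lt hx (half_pos hr)
  obtain ⟨N, hN⟩ := h.exists_pathProd_mem_Ico v (t := 2 * R / (c * τ)) (by positivity)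
    ((div_le_one (by positivity)).2 hR)
  obtain ⟨M, hM⟩ := h.exists_pathProd_mem_Ico v (half_pos hr) (by linarith)
  have hN' : pathProd a b v N ∈ Ico (2 * R / τ) (2 * R / (c * τ)) := by
    convert hN using 2
    field_simp
  have hRN : 2 * R ≤ τ * pathProd a b v N := by
    rw [← div_le_iff₀' hτ]
    exact hN'.1
  have hNM : N ≤ M := by
    refine ((h.antitone_pathProd v).reflect_lt (hM.2.trans ?_)).le
    nlinarith [h.gap_lt_one, h.pathProd_pos v N]
  obtain ⟨k, rfl⟩ := Nat.exists_eq_add_of_le hNM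
  refine ⟨v, N, k, hN', hM, ?_⟩
  rw [ENNReal.ofReal_div_of_pos (pathProd_one_sub_pos hp v _)]
  refine ENNReal.div_le_div ?_ ?_
  · refine (measure_mono (Metric.ball_subset_ball' ?_)).trans (h.moranMeasure_ball_le v hRN)
    linarith [dist_comm x (moranPoint a b v)]
  · refine (h.le_moranMeasure_ball v hM.2).trans (measure_mono (Metric.ball_subset_ball' ?_))
    linarith

end MoranRatioBounds

/-! ### Bounding upper dimensions -/

section UpperPhiDim

variable {X : Type*} [PseudoMetricSpace X] [MeasurableSpace X] {Φ : ℝ → ℝ} {μ : Measure X} {d : ℝ}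

lemma upperPhiDim_le_of_eventually {C : ℝ} (hC : 0 < C)
    (h : ∀ᶠ R in 𝓝[>] (0 : ℝ), ∀ r, 0 < r → r < R ^ (1 + Φ R) → R ^ (1 + Φ R) ≤ R →
      ∀ x ∈ μ.support,
        μ (Metric.ball x R) / μ (Metric.ball x r) ≤ ENNReal.ofReal (C * (R / r) ^ d)) :
    upperPhiDim Φ μ ≤ d := by
  obtain ⟨ε, hε, hsub⟩ := mem_nhdsGT_iff_exists_Ioc_subset.1 h
  refine sInf_le ⟨d, ⟨min ε (1 / 2), C, lt_min hε one_half_pos, ?_, hC, ?_⟩, rfl⟩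
  · exact (min_le_right _ _).trans_lt one_half_lt_one
  · intro r R hr hrR hRR hR
    exact hsub ⟨hr.trans (hrR.trans_le hRR), hR.trans (min_le_left _ _)⟩ r hr hrR hRR

lemma le_upperPhiDim_of_tendsto [IsFiniteMeasure μ] (hΦ : ∀ t ∈ Ioo (0 : ℝ) 1, 0 ≤ Φ t) {x : X}
    (hx : x ∈ μ.support) {r : ℕ → ℝ} (hr : ∀ n, 0 < r n) (hr₀ : Tendsto r atTop (𝓝 0))
    (hμ : Tendsto (fun n => μ.real (Metric.ball x (r n)) / r n ^ d) atTop (𝓝 0)) :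
    (d : EReal) ≤ upperPhiDim Φ μ := by
  refine le_sInf ?_
  rintro _ ⟨D, ⟨R, C, hR₀, hR₁, hC, hball⟩, rfl⟩
  rw [EReal.coe_le_coe_iff]
  by_contra! hD
  have hpos : ∀ s, 0 < s → 0 < μ (Metric.ball x s) := fun s hs =>
    (Measure.mem_support_iff_forall x).1 hx _ (Metric.ball_mem_nhds x hs)
  have hRΦ : 0 < R ^ (1 + Φ R) := Real.rpow_pos_of_pos hR₀ _
  have hRR : R ^ (1 + Φ R) ≤ R := by
    simpa using Real.rpow_le_rpow_of_exponent_ge hR₀ hR₁.le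
      (show 1 ≤ 1 + Φ R by linarith [hΦ R ⟨hR₀, hR₁⟩])
  have hlow : ∀ᶠ n in atTop, μ.real (Metric.ball x R) / (C * R ^ D) ≤
      μ.real (Metric.ball x (r n)) / r n ^ d := by
    filter_upwards [hr₀.eventually_lt_const hRΦ, hr₀.eventually_lt_const one_pos] with n hn hn₁
    have hreal := ENNReal.toReal_mono ENNReal.ofReal_ne_top
      (hball (r n) R (hr n) hn hRR le_rfl x hx)
    rw [ENNReal.toReal_div, ENNReal.toReal_ofReal (by have := hr n; positivity),
      Real.div_rpow hR₀.le (hr n).le] at hreal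
    have hball_pos : 0 < μ.real (Metric.ball x (r n)) :=
      ENNReal.toReal_pos (hpos _ (hr n)).ne' (measure_ne_top _ _)
    have hDd : r n ^ d ≤ r n ^ D := Real.rpow_le_rpow_of_exponent_ge (hr n) hn₁.le hD.le
    have hrd : 0 < r n ^ d := Real.rpow_pos_of_pos (hr n) d
    calc μ.real (Metric.ball x R) / (C * R ^ D)
        ≤ C * (R ^ D / r n ^ D) * μ.real (Metric.ball x (r n)) / (C * R ^ D) := by
          refine div_le_div_of_nonneg_right ?_ (by positivity)
          exact (div_le_iff₀ hball_pos).1 hreal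
      _ = μ.real (Metric.ball x (r n)) / r n ^ D := by
          have : 0 < R ^ D := by positivity
          field_simp
      _ ≤ μ.real (Metric.ball x (r n)) / r n ^ d := by gcongr
  have hball_pos : 0 < μ.real (Metric.ball x R) :=
    ENNReal.toReal_pos (hpos R hR₀).ne' (measure_ne_top _ _)
  exact (ge_of_tendsto hμ hlow).not_gt (by positivity)

end UpperPhiDim

/-! ### Levels and scales -/

lemma tendsto_abs_log_nhdsGT_zero : Tendsto (fun R => |Real.log R|) (𝓝[>] 0) atTop :=
  tendsto_abs_atBot_atTop.comp Real.tendsto_log_nhdsGT_zero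

lemma eventually_le_of_pow_lt_mul {c : ℝ} (hc : 0 < c) (hc₁ : c ≤ 1) (K : ℝ) (N₀ : ℕ) :
    ∀ᶠ R in 𝓝[>] (0 : ℝ), ∀ N, c ^ N < K * R → N₀ ≤ N := by
  have hlim : Tendsto (fun R => K * R) (𝓝[>] 0) (𝓝 0) :=
    ((continuous_const_mul K).tendsto' 0 0 (mul_zero K)).mono_left nhdsWithin_le_nhds
  filter_upwards [hlim.eventually_lt_const (pow_pos hc N₀)] with R hR N hN
  by_contra! hlt
  exact (hN.trans hR).not_ge (pow_le_pow_of_le_one hc.le hc₁ hlt.le)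

lemma eventually_log_le_of_mul_le_pow {c K : ℝ} (hc : 0 < c) (hc₁ : c < 1) (hK : 0 < K) :
    ∀ᶠ R in 𝓝[>] (0 : ℝ), ∀ N : ℕ, K * R ≤ c ^ N →
      Real.log (N + 1) ≤ 2 * Real.log |Real.log R| := by
  have hlogc : Real.log c < 0 := Real.log_neg hc hc₁
  have hquad : ∀ᶠ T : ℝ in atTop, (T - Real.log K) / -Real.log c + 1 ≤ T ^ 2 := by
    filter_upwards [eventually_ge_atTop ((-Real.log c)⁻¹ + 1),
      eventually_ge_atTop (1 - Real.log K / -Real.log c)] with T hT hT'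
    have hT₀ : 0 ≤ T := by linarith [inv_pos.2 (neg_pos.2 hlogc)]
    calc (T - Real.log K) / -Real.log c + 1
        = T * (-Real.log c)⁻¹ + (1 - Real.log K / -Real.log c) := by ring
      _ ≤ T * ((-Real.log c)⁻¹ + 1) := by linarith
      _ ≤ T ^ 2 := by rw [sq]; gcongr
  filter_upwards [self_mem_nhdsWithin, tendsto_abs_log_nhdsGT_zero.eventually hquad,
    Ioo_mem_nhdsGT one_pos] with R hR₀ hR hR₁ N hN
  have hlog : Real.log K + Real.log R ≤ N * Real.log c := by
    rw [← Real.log_mul hK.ne' (ne_of_gt hR₀), ← Real.log_pow]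
    exact Real.log_le_log (mul_pos hK hR₀) hN
  have hN_le : (N : ℝ) ≤ (|Real.log R| - Real.log K) / -Real.log c := by
    rw [abs_of_neg (Real.log_neg hR₀ hR₁.2), le_div_iff₀ (neg_pos.2 hlogc)]
    linarith
  calc Real.log (N + 1) ≤ Real.log (|Real.log R| ^ 2) :=
        Real.log_le_log (by positivity) (by linarith)
    _ = 2 * Real.log |Real.log R| := by rw [Real.log_pow, Nat.cast_ofNat]

lemma IsLargeDimensionFunction.eventually_mul_log_le {Φ : ℝ → ℝ} (hΦ : IsLargeDimensionFunction Φ)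
    {c : ℝ} (hc : 0 < c) (hc₁ : c < 1) (B : ℝ) :
    ∀ᶠ R in 𝓝[>] (0 : ℝ), ∀ r, r < R ^ (1 + Φ R) → ∀ k : ℕ, c ^ k * R < r →
      B * Real.log |Real.log R| ≤ k := by
  obtain ⟨-, H, hH, hΦH⟩ := hΦ
  have hlogc : Real.log c < 0 := Real.log_neg hc hc₁
  filter_upwards [hΦH, hH.eventually_ge_atTop (B * -Real.log c), Ioo_mem_nhdsGT one_pos,
    tendsto_abs_log_nhdsGT_zero.eventually_ge_atTop 1] with R hΦR hHR hR hlogR r hrR k hk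
  have hloglog : 0 ≤ Real.log |Real.log R| := Real.log_nonneg hlogR
  have hΦlog : Φ R * Real.log R = -(H R * Real.log |Real.log R|) := by
    rw [hΦR, abs_of_neg (Real.log_neg hR.1 hR.2)]
    field_simp [(Real.log_neg hR.1 hR.2).ne]
  have hlog : k * Real.log c + Real.log R < (1 + Φ R) * Real.log R := by
    rw [← Real.log_pow, ← Real.log_mul (pow_pos hc k).ne' hR.1.ne', ← Real.log_rpow hR.1]
    exact Real.log_lt_log (mul_pos (pow_pos hc k) hR.1) (hk.trans hrR)
  have hk' : B * -Real.log c * Real.log |Real.log R| ≤ k * -Real.log c :=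
    calc B * -Real.log c * Real.log |Real.log R| ≤ H R * Real.log |Real.log R| := by gcongr
      _ ≤ k * -Real.log c := by linarith
  refine le_of_mul_le_mul_right ?_ (neg_pos.2 hlogc)
  linarith

/-! ### Moran measures and products of branch maxima -/

/-- The larger of the quotients `|J| ^ d / mass of J` over the children `J` of an interval of length
and mass `1`, when the ratios are `a`, `b` and the left child receives the proportion `x`. -/
noncomputable def maxBranch (a b d x : ℝ) : ℝ :=
  max (a ^ d / x) (b ^ d / (1 - x))

section MaxBranch

variable {a b d x : ℝ}

lemma maxBranch_pos (ha : 0 < a) (hx : 0 < x) : 0 < maxBranch a b d x :=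
  lt_max_of_lt_left (div_pos (Real.rpow_pos_of_pos ha d) hx)

lemma ite_rpow_le_mul_maxBranch (hx : x ∈ Ioo (0 : ℝ) 1) (s : Bool) :
    (if s then b else a) ^ d ≤ (if s then 1 - x else x) * maxBranch a b d x := by
  cases s
  · exact (div_le_iff₀' hx.1).1 (le_max_left _ _)
  · exact (div_le_iff₀' (sub_pos.2 hx.2)).1 (le_max_right _ _)

lemma exists_ite_rpow_eq_mul_maxBranch (a b d : ℝ) (hx : x ∈ Ioo (0 : ℝ) 1) :
    ∃ s : Bool, (if s then b else a) ^ d = (if s then 1 - x else x) * maxBranch a b d x := by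
  rcases max_choice (a ^ d / x) (b ^ d / (1 - x)) with h | h
  · exact ⟨false, by rw [maxBranch, h]; exact (mul_div_cancel₀ _ hx.1.ne').symm⟩
  · exact ⟨true, by rw [maxBranch, h]; exact (mul_div_cancel₀ _ (sub_pos.2 hx.2).ne').symm⟩

end MaxBranch

section Products

variable {a b x : ℕ → ℝ}

lemma pathProd_rpow (ha : ∀ i, 0 ≤ a i) (hb : ∀ i, 0 ≤ b i) (v : ℕ → Bool) (n : ℕ) (d : ℝ) :
    pathProd a b v n ^ d = ∏ i ∈ Finset.range n, (if v i then b i else a i) ^ d :=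
  (Real.finsetProd_rpow _ _ (fun i _ => by split_ifs <;> simp only [ha, hb]) d).symm

lemma pathProd_rpow_le (ha : ∀ i, 0 ≤ a i) (hb : ∀ i, 0 ≤ b i) (hx : ∀ i, x i ∈ Ioo (0 : ℝ) 1)
    (v : ℕ → Bool) (n : ℕ) (d : ℝ) :
    pathProd a b v n ^ d ≤ pathProd x (fun i => 1 - x i) v n *
      ∏ i ∈ Finset.range n, maxBranch (a i) (b i) d (x i) := by
  rw [pathProd_rpow ha hb, pathProd, ← Finset.prod_mul_distrib]
  refine Finset.prod_le_prod (fun i _ => Real.rpow_nonneg ?_ d)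
    fun i _ => ite_rpow_le_mul_maxBranch (hx i) (v i)
  split_ifs <;> simp only [ha, hb]

lemma exists_pathProd_rpow_eq (ha : ∀ i, 0 ≤ a i) (hb : ∀ i, 0 ≤ b i)
    (hx : ∀ i, x i ∈ Ioo (0 : ℝ) 1) (d : ℝ) :
    ∃ v, ∀ n, pathProd a b v n ^ d = pathProd x (fun i => 1 - x i) v n *
      ∏ i ∈ Finset.range n, maxBranch (a i) (b i) d (x i) := by
  choose v hv using fun i => exists_ite_rpow_eq_mul_maxBranch (a i) (b i) d (hx i)
  refine ⟨v, fun n => ?_⟩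
  rw [pathProd_rpow ha hb, pathProd, ← Finset.prod_mul_distrib]
  exact Finset.prod_congr rfl fun i _ => hv i

lemma pathProd_div_le_rpow (ha : ∀ i, 0 < a i) (hb : ∀ i, 0 < b i)
    (hx : ∀ i, x i ∈ Ioo (0 : ℝ) 1) {d : ℝ} {n k : ℕ}
    (hprod : ∏ i ∈ Finset.range k, maxBranch (a (n + i)) (b (n + i)) d (x (n + i)) ≤ 1)
    (v : ℕ → Bool) :
    pathProd x (fun i => 1 - x i) v n / pathProd x (fun i => 1 - x i) v (n + k) ≤
      (pathProd a b v n / pathProd a b v (n + k)) ^ d := by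
  have hLn := pathProd_pos ha hb v n
  have hQn := pathProd_one_sub_pos hx v n
  have hL := pathProd_pos (fun i => ha (n + i)) (fun i => hb (n + i)) (fun i => v (n + i)) k
  have hQ := pathProd_one_sub_pos (fun i => hx (n + i)) (fun i => v (n + i)) k
  have hLQ := (pathProd_rpow_le (fun i => (ha (n + i)).le) (fun i => (hb (n + i)).le)
    (fun i => hx (n + i)) (fun i => v (n + i)) k d).trans (mul_le_of_le_one_right hQ.le hprod)
  rw [pathProd_add, pathProd_add, div_mul_cancel_left₀ hQn.ne', div_mul_cancel_left₀ hLn.ne',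
    Real.inv_rpow hL.le]
  exact inv_anti₀ (Real.rpow_pos_of_pos hL d) hLQ

end Products

namespace MoranRatioBounds

variable {a b : ℕ → ℝ} {c τ d : ℝ} {p : ℕ → unitInterval} {Φ : ℝ → ℝ}

lemma upperPhiDim_moranMeasure_le (h : MoranRatioBounds a b c τ)
    (hp : ∀ n, (p n : ℝ) ∈ Ioo (0 : ℝ) 1) (hd : 0 ≤ d) {A : ℝ} (hA : 0 ≤ A)
    (hprod : ∀ᶠ n : ℕ in atTop, ∀ k : ℕ, A * Real.log (n + 1) ≤ k →
      ∏ i ∈ Finset.range k, maxBranch (a (n + i)) (b (n + i)) d (p (n + i)) ≤ 1)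
    (hΦ : IsLargeDimensionFunction Φ) :
    upperPhiDim Φ (moranMeasure a b p) ≤ d := by
  obtain ⟨N₀, hN₀⟩ := eventually_atTop.1 hprod
  have hc := h.pos
  have hτ := h.gap_pos
  have hτ₁ := h.gap_lt_one
  refine upperPhiDim_le_of_eventually (C := (4 / (c ^ 2 * τ)) ^ d) (by positivity) ?_
  filter_upwards [eventually_le_of_pow_lt_mul hc h.lt_one.le (2 / (c * τ)) N₀,
    eventually_log_le_of_mul_le_pow (sub_pos.2 hτ₁) (by linarith : 1 - τ < 1) (div_pos two_pos hτ),
    hΦ.eventually_mul_log_le hc h.lt_one (A * 2),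
    Ioc_mem_nhdsGT (show 0 < c * τ / 2 by positivity)] with R hlevel hlog hgap hR r hr hrR hRR x hx
  obtain ⟨v, N, k, hN, hNk, hratio⟩ :=
    h.exists_moranMeasure_ball_div_le hp hx hr (hrR.le.trans hRR) (by linarith [hR.2])
  have hN_large : N₀ ≤ N := by
    refine hlevel N ((h.pow_le_pathProd v N).trans_lt ?_)
    rw [div_mul_eq_mul_div]
    exact hN.2
  have hN_small : Real.log (N + 1) ≤ 2 * Real.log |Real.log R| := by
    refine hlog N (le_trans ?_ (h.pathProd_le_pow v N))
    rw [div_mul_eq_mul_div]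
    exact hN.1
  have hk : A * 2 * Real.log |Real.log R| ≤ k := by
    refine hgap r hrR k ?_
    have hRN : R ≤ pathProd a b v N :=
      le_trans (by rw [le_div_iff₀ hτ]; nlinarith [hR.1]) hN.1
    calc c ^ k * R ≤ c ^ k * pathProd a b v N := by gcongr
      _ ≤ pathProd a b v (N + k) := h.pow_mul_pathProd_le v N k
      _ < r := by linarith [hNk.2]
  have hlength : pathProd a b v N / pathProd a b v (N + k) ≤ 4 / (c ^ 2 * τ) * (R / r) :=
    calc pathProd a b v N / pathProd a b v (N + k) ≤ 2 * R / (c * τ) / (c * (r / 2)) :=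
          div_le_div₀ (by have := hR.1; positivity) hN.2.le (by positivity) hNk.1
      _ = 4 / (c ^ 2 * τ) * (R / r) := by field_simp; ring
  refine hratio.trans (ENNReal.ofReal_le_ofReal ?_)
  rw [← Real.mul_rpow (by positivity) (div_nonneg hR.1.le hr.le)]
  refine (pathProd_div_le_rpow h.left_pos h.right_pos hp (hN₀ N hN_large k ?_) v).trans
    (Real.rpow_le_rpow (div_nonneg (h.pathProd_pos v _).le (h.pathProd_pos v _).le) hlength hd)
  calc A * Real.log (N + 1) ≤ A * (2 * Real.log |Real.log R|) := by gcongr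
    _ ≤ k := by linarith

lemma le_upperPhiDim_moranMeasure (h : MoranRatioBounds a b c τ)
    (hp : ∀ n, (p n : ℝ) ∈ Ioo (0 : ℝ) 1)
    (hprod : Tendsto (fun n => ∏ i ∈ Finset.range n, maxBranch (a i) (b i) d (p i)) atTop atTop)
    (hΦ : ∀ t ∈ Ioo (0 : ℝ) 1, 0 ≤ Φ t) :
    (d : EReal) ≤ upperPhiDim Φ (moranMeasure a b p) := by
  obtain ⟨v, hv⟩ := exists_pathProd_rpow_eq (fun i => (h.left_pos i).le)
    (fun i => (h.right_pos i).le) hp d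
  have hτ := h.gap_pos
  refine le_upperPhiDim_of_tendsto hΦ (h.moranPoint_mem_support hp v)
    (r := fun n => τ * pathProd a b v n) (fun n => mul_pos hτ (h.pathProd_pos v n))
    (by simpa using (h.tendsto_pathProd v).const_mul τ) ?_
  refine squeeze_zero (fun n => div_nonneg measureReal_nonneg (Real.rpow_nonneg
    (mul_pos hτ (h.pathProd_pos v n)).le d)) (fun n => ?_)
    (by simpa using hprod.inv_tendsto_atTop.const_mul (τ ^ d)⁻¹)
  have hL := h.pathProd_pos v n
  have hQ := pathProd_one_sub_pos hp v n
  have hmass : (moranMeasure a b p).real (Metric.ball (moranPoint a b v) (τ * pathProd a b v n)) ≤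
      pathProd (fun i => p i) (fun i => 1 - p i) v n :=
    ENNReal.toReal_le_of_le_ofReal hQ.le (h.moranMeasure_ball_le v le_rfl)
  have hW : 0 < ∏ i ∈ Finset.range n, maxBranch (a i) (b i) d (p i) :=
    Finset.prod_pos fun i _ => maxBranch_pos (h.left_pos i) (hp i).1
  rw [Real.mul_rpow hτ.le hL.le, hv n]
  refine (div_le_div_of_nonneg_right hmass (by positivity)).trans_eq ?_
  field_simp

end MoranRatioBounds

/-! ### Uniform random variables and skew tent maps -/

/-- The skew tent map with peak `1` at `q`: it is linear on `[0, q]` and on `[q, 1]`, and maps both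
intervals onto `[0, 1]`. -/
noncomputable def skewTent (q x : ℝ) : ℝ :=
  min (x / q) ((1 - x) / (1 - q))

lemma measurable_skewTent (q : ℝ) : Measurable (skewTent q) :=
  (measurable_id.div_const q).min ((measurable_const.sub measurable_id).div_const (1 - q))

lemma skewTent_preimage_Ici {q : ℝ} (hq : q ∈ Ioo (0 : ℝ) 1) (t : ℝ) :
    skewTent q ⁻¹' Ici t = Icc (t * q) (1 - t * (1 - q)) := by
  ext x
  simp only [skewTent, mem_preimage, mem_Ici, le_min_iff, le_div_iff₀ hq.1,
    le_div_iff₀ (sub_pos.2 hq.2), mem_Icc, le_sub_comm]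

lemma measurePreserving_skewTent {q : ℝ} (hq : q ∈ Ioo (0 : ℝ) 1) :
    MeasurePreserving (skewTent q) (volume.restrict (Icc 0 1)) (volume.restrict (Icc 0 1)) := by
  refine ⟨measurable_skewTent q, Measure.ext_of_Ici _ _ fun t => ?_⟩
  rw [Measure.map_apply (measurable_skewTent q) measurableSet_Ici, skewTent_preimage_Ici hq,
    Measure.restrict_apply measurableSet_Icc, Measure.restrict_apply measurableSet_Ici,
    Icc_inter_Icc, ← Ici_inter_Iic (a := (0 : ℝ)), ← inter_assoc, Ici_inter_Ici, Ici_inter_Iic,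
    Real.volume_Icc, Real.volume_Icc]
  rcases le_total t 0 with ht | ht
  · rw [sup_eq_right.2 (mul_nonpos_of_nonpos_of_nonneg ht hq.1.le), sup_eq_right.2 ht,
      inf_eq_right.2 (by nlinarith [hq.2])]
  · rw [sup_eq_left.2 (mul_nonneg ht hq.1.le), sup_eq_left.2 ht,
      inf_eq_left.2 (by nlinarith [hq.2])]
    ring_nf

lemma maxBranch_eq_div_skewTent {a b x : ℝ} (ha : 0 < a) (hb : 0 < b) (hx : x ∈ Ioo (0 : ℝ) 1)
    (d : ℝ) :
    maxBranch a b d x = (a ^ d + b ^ d) / skewTent (a ^ d / (a ^ d + b ^ d)) x := by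
  have hA := Real.rpow_pos_of_pos ha d
  have hB := Real.rpow_pos_of_pos hb d
  have hx' : 0 < 1 - x := sub_pos.2 hx.2
  have hcompl : 1 - a ^ d / (a ^ d + b ^ d) = b ^ d / (a ^ d + b ^ d) := by field_simp; ring
  have hx₀ := hx.1
  rw [skewTent, hcompl, maxBranch]
  have hanti : AntitoneOn (fun u => (a ^ d + b ^ d) / u) (Ioi 0) := fun u hu _ _ huv =>
    div_le_div_of_nonneg_left (add_pos hA hB).le hu huv
  rw [hanti.map_min (mem_Ioi.2 (by positivity)) (mem_Ioi.2 (by positivity))]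
  congr 1 <;> field_simp

section Uniform

variable {Ω : Type*} [MeasurableSpace Ω] {P : Measure Ω} {U : Ω → ℝ}

lemma measurePreserving_of_isUniform {E : Type*} [MeasurableSpace E] {μ : Measure E} {s : Set E}
    {X : Ω → E} (hX : Measurable X) (hunif : pdf.IsUniform X s P μ) (hs : μ s = 1) :
    MeasurePreserving X P (μ.restrict s) :=
  ⟨hX, by rw [hunif, ProbabilityTheory.cond, hs, inv_one, one_smul]⟩

lemma ae_mem_Ioo_of_uniform (hU : MeasurePreserving U P (volume.restrict (Icc 0 1))) :
    ∀ᵐ ω ∂P, U ω ∈ Ioo (0 : ℝ) 1 := by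
  refine hU.quasiMeasurePreserving.ae ?_
  rw [← restrict_Ioo_eq_restrict_Icc]
  exact ae_restrict_mem measurableSet_Ioo

lemma measureReal_le_of_uniform (hU : MeasurePreserving U P (volume.restrict (Icc 0 1))) {q : ℝ}
    (hq : q ∈ Icc (0 : ℝ) 1) : P.real {ω | U ω ≤ q} = q := by
  have hinter : Iic q ∩ Icc 0 1 = Icc 0 q := by
    ext x
    simp only [mem_inter_iff, mem_Iic, mem_Icc]
    exact ⟨fun h => ⟨h.2.1, h.1⟩, fun h => ⟨h.2, h.1, h.2.trans hq.2⟩⟩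
  change P.real (U ⁻¹' Iic q) = q
  rw [hU.measureReal_preimage measurableSet_Iic.nullMeasurableSet,
    measureReal_restrict_apply measurableSet_Iic, hinter, Real.volume_real_Icc_of_le hq.1, sub_zero]

lemma integrable_ite_le [IsFiniteMeasure P] (hU : Measurable U) (q y z : ℝ) :
    Integrable (fun ω => if U ω ≤ q then y else z) P :=
  Integrable.piecewise (s := {ω | U ω ≤ q}) (hU measurableSet_Iic) integrableOn_const
    integrableOn_const

lemma integral_ite_le_of_uniform [IsProbabilityMeasure P]
    (hU : MeasurePreserving U P (volume.restrict (Icc 0 1))) {q : ℝ} (hq : q ∈ Icc (0 : ℝ) 1)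
    (y z : ℝ) : ∫ ω, (if U ω ≤ q then y else z) ∂P = q * y + (1 - q) * z := by
  have hmeas : MeasurableSet {ω | U ω ≤ q} := hU.measurable measurableSet_Iic
  have hpiece : (fun ω => if U ω ≤ q then y else z) =
    piecewise {ω | U ω ≤ q} (fun _ => y) fun _ => z := rfl
  rw [hpiece, integral_piecewise hmeas integrableOn_const integrableOn_const, setIntegral_const,
    setIntegral_const, probReal_compl_eq_one_sub hmeas, measureReal_le_of_uniform hU hq,
    smul_eq_mul, smul_eq_mul]

lemma integrable_log_of_uniform (hU : MeasurePreserving U P (volume.restrict (Icc 0 1))) :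
    Integrable (fun ω => Real.log (U ω)) P := by
  refine hU.integrable_comp_of_integrable (g := Real.log) ?_
  exact (intervalIntegrable_iff_integrableOn_Icc_of_le zero_le_one).1
    intervalIntegral.intervalIntegrable_log'

lemma integral_log_of_uniform (hU : MeasurePreserving U P (volume.restrict (Icc 0 1))) :
    ∫ ω, Real.log (U ω) ∂P = -1 := by
  rw [← integral_map (f := Real.log) hU.measurable.aemeasurable
    Real.measurable_log.aestronglyMeasurable, hU.map_eq, integral_Icc_eq_integral_Ioc,
    ← intervalIntegral.integral_of_le zero_le_one, integral_log]
  simp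

lemma zero_mem_interior_integrableExpSet_sub_log
    (hU : MeasurePreserving U P (volume.restrict (Icc 0 1))) (s : ℝ) :
    0 ∈ interior (integrableExpSet (fun ω => s - Real.log (U ω)) P) := by
  refine mem_interior.2 ⟨Iio 1, fun t ht => ?_, isOpen_Iio, mem_Iio.2 one_pos⟩
  refine hU.integrable_comp_of_integrable (g := fun x => Real.exp (t * (s - Real.log x))) ?_
  have hpow : IntegrableOn (fun x : ℝ => x ^ (-t)) (Ioo 0 1) :=
    (intervalIntegrable_iff_integrableOn_Ioo_of_le zero_le_one).1
      (intervalIntegral.intervalIntegrable_rpow' (neg_lt_neg ht))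
  have hexp : EqOn (fun x => Real.exp (t * s) * x ^ (-t))
      (fun x => Real.exp (t * (s - Real.log x))) (Ioo 0 1) := fun x hx => by
    simp only [Real.rpow_def_of_pos hx.1, ← Real.exp_add]
    ring_nf
  rw [← restrict_Ioo_eq_restrict_Icc]
  exact IntegrableOn.congr_fun (hpow.const_mul (Real.exp (t * s))) hexp measurableSet_Ioo

end Uniform

/-! ### Sums of independent identically distributed random variables -/

section Iid

variable {Ω : Type*} [MeasurableSpace Ω] {P : Measure Ω}

lemma exists_pos_mgf_lt_one [IsProbabilityMeasure P] {X : Ω → ℝ}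
    (hX : 0 ∈ interior (integrableExpSet X P)) (hmean : P[X] < 0) :
    ∃ t, 0 < t ∧ t ∈ integrableExpSet X P ∧ mgf X P t < 1 := by
  have hderiv : deriv (fun t => mgf X P t - 1) 0 < 0 := by rwa [deriv_sub_const, deriv_mgf_zero hX]
  have hzero : mgf X P 0 - 1 = 0 := by rw [mgf_zero, sub_self]
  have hsign := eventually_nhdsWithin_sign_eq_of_deriv_neg hderiv hzero
  obtain ⟨t, ⟨hts, htX⟩, ht⟩ := (((hsign.and (mem_interior_iff_mem_nhds.1 hX)).filter_mono
    nhdsWithin_le_nhds).and (self_mem_nhdsWithin (s := Ioi (0 : ℝ)))).exists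
  rw [zero_sub, sign_neg (neg_neg_of_pos ht), sign_eq_neg_one_iff] at hts
  exact ⟨t, ht, htX, sub_neg.1 hts⟩

lemma measureReal_zero_le_sum_le [IsFiniteMeasure P] {ι : Type*} {X : ι → Ω → ℝ} {Y : Ω → ℝ}
    (hX : ∀ i, Measurable (X i)) (hindep : iIndepFun X P) (hident : ∀ i, IdentDistrib (X i) Y P P)
    {t : ℝ} (ht : 0 ≤ t) (hint : t ∈ integrableExpSet Y P) (s : Finset ι) :
    P.real {ω | 0 ≤ ∑ i ∈ s, X i ω} ≤ mgf Y P t ^ s.card := by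
  have hintX : ∀ i, Integrable (fun ω => Real.exp (t * X i ω)) P := fun i =>
    ((hident i).comp (u := fun x => Real.exp (t * x)) (by fun_prop)).integrable_iff.2 hint
  have hchernoff := measure_ge_le_exp_mul_mgf (X := ∑ i ∈ s, X i) 0 ht
    (hindep.integrable_exp_mul_sum hX fun i _ => hintX i)
  rw [hindep.mgf_sum hX, Finset.prod_congr rfl fun i _ =>
    congrFun (mgf_congr_identDistrib (hident i)) t, Finset.prod_const, mul_zero, Real.exp_zero,
    one_mul] at hchernoff
  simpa only [Finset.sum_apply] using hchernoff

lemma pow_le_rpow_mul_sqrt_pow {ρ : ℝ} (hρ : ρ ∈ Ioo (0 : ℝ) 1) {n k : ℕ}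
    (hk : 2 / -Real.log √ρ * Real.log (n + 1) ≤ k) :
    ρ ^ k ≤ (n + 1 : ℝ) ^ (-2 : ℝ) * √ρ ^ k := by
  have hσ : 0 < √ρ := Real.sqrt_pos.2 hρ.1
  have hlog : 0 < -Real.log √ρ :=
    neg_pos.2 (Real.log_neg hσ ((Real.sqrt_lt_sqrt hρ.1.le hρ.2).trans_eq Real.sqrt_one))
  have hn : (0 : ℝ) < n + 1 := by positivity
  have hmul : 2 * Real.log (n + 1) ≤ k * -Real.log √ρ := by
    rwa [div_mul_eq_mul_div, div_le_iff₀ hlog] at hk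
  calc ρ ^ k = √ρ ^ k * √ρ ^ k := by rw [← mul_pow, Real.mul_self_sqrt hρ.1.le]
    _ ≤ (n + 1 : ℝ) ^ (-2 : ℝ) * √ρ ^ k := by
      gcongr
      rw [← Real.log_le_log_iff (by positivity) (by positivity), Real.log_pow, Real.log_rpow hn]
      linarith

lemma ae_eventually_notMem_of_measure_le_pow {E : ℕ → ℕ → Set Ω} {ρ : ℝ} (hρ : ρ ∈ Ioo (0 : ℝ) 1)
    (hE : ∀ n k, P (E n k) ≤ ENNReal.ofReal (ρ ^ k)) :
    ∃ A ≥ 0, ∀ᵐ ω ∂P, ∀ᶠ n : ℕ in atTop, ∀ k : ℕ, A * Real.log (n + 1) ≤ k → ω ∉ E n k := by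
  have hσ : √ρ < 1 := (Real.sqrt_lt_sqrt hρ.1.le hρ.2).trans_eq Real.sqrt_one
  set A := 2 / -Real.log √ρ
  refine ⟨A, div_nonneg zero_le_two
    (neg_nonneg.2 (Real.log_nonpos (Real.sqrt_nonneg ρ) hσ.le)), ?_⟩
  let F : ℕ × ℕ → Set Ω := fun q => {ω | A * Real.log (q.1 + 1) ≤ q.2 ∧ ω ∈ E q.1 q.2}
  have hF : ∀ q, P (F q) ≤ ENNReal.ofReal (((q.1 : ℝ) + 1) ^ (-2 : ℝ) * √ρ ^ q.2) := by
    rintro ⟨n, k⟩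
    by_cases hk : A * Real.log (n + 1) ≤ k
    · exact (measure_mono fun ω hω => hω.2).trans
        ((hE n k).trans (ENNReal.ofReal_le_ofReal (pow_le_rpow_mul_sqrt_pow hρ hk)))
    · have hempty : F (n, k) = ∅ := eq_empty_of_forall_notMem fun ω hω => hk hω.1
      rw [hempty, measure_empty]
      exact zero_le
  have hsummable : Summable fun q : ℕ × ℕ => ((q.1 : ℝ) + 1) ^ (-2 : ℝ) * √ρ ^ q.2 := by
    have hrpow : Summable fun n : ℕ => ((n : ℝ) + 1) ^ (-2 : ℝ) := by
      simpa only [Nat.cast_succ] using (summable_nat_add_iff 1).2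
        (Real.summable_nat_rpow.2 (by norm_num : (-2 : ℝ) < -1))
    exact hrpow.mul_of_nonneg (summable_geometric_of_lt_one (Real.sqrt_nonneg ρ) hσ)
      (fun n => by positivity) fun k => by positivity
  have htsum : ∑' q, P (F q) ≠ ⊤ :=
    ne_top_of_le_ne_top hsummable.tsum_ofReal_ne_top (ENNReal.tsum_le_tsum hF)
  filter_upwards [ae_finite_setOfPred_mem htsum] with ω hfin
  obtain ⟨N, hN⟩ := (hfin.image Prod.fst).bddAbove
  filter_upwards [eventually_gt_atTop N] with n hn k hk hmem
  exact (hN ⟨(n, k), ⟨hk, hmem⟩, rfl⟩).not_gt hn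

section

variable {X : ℕ → Ω → ℝ}

lemma ae_eventually_sum_neg_of_integral_neg [IsProbabilityMeasure P] (hX : ∀ i, Measurable (X i))
    (hindep : iIndepFun X P) (hident : ∀ i, IdentDistrib (X i) (X 0) P P)
    (hexp : 0 ∈ interior (integrableExpSet (X 0) P)) (hmean : P[X 0] < 0) :
    ∃ A ≥ 0, ∀ᵐ ω ∂P, ∀ᶠ n : ℕ in atTop, ∀ k : ℕ, A * Real.log (n + 1) ≤ k →
      ∑ i ∈ Finset.range k, X (n + i) ω < 0 := by
  obtain ⟨t, ht, htX, hlt⟩ := exists_pos_mgf_lt_one hexp hmean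
  obtain ⟨A, hA, hae⟩ := ae_eventually_notMem_of_measure_le_pow (P := P)
    (E := fun n k => {ω | 0 ≤ ∑ i ∈ Finset.range k, X (n + i) ω}) ⟨mgf_pos htX, hlt⟩ fun n k => by
      have hshift := measureReal_zero_le_sum_le (fun i => hX (n + i))
        (hindep.precomp (add_right_injective n)) (fun i => hident (n + i)) ht.le htX
        (Finset.range k)
      rw [Finset.card_range] at hshift
      rw [← ofReal_measureReal]
      exact ENNReal.ofReal_le_ofReal hshift
  exact ⟨A, hA, hae.mono fun ω hω => hω.mono fun n hn k hk => not_le.1 (hn k hk)⟩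

lemma ae_tendsto_sum_atTop_of_integral_pos (hint : Integrable (X 0) P) (hindep : iIndepFun X P)
    (hident : ∀ i, IdentDistrib (X i) (X 0) P P) (hmean : 0 < P[X 0]) :
    ∀ᵐ ω ∂P, Tendsto (fun n => ∑ i ∈ Finset.range n, X i ω) atTop atTop := by
  filter_upwards [strong_law_ae_real X hint (fun i j hij => hindep.indepFun hij) hident]
    with ω hlim
  refine (hlim.pos_mul_atTop hmean tendsto_natCast_atTop_atTop).congr' ?_
  filter_upwards [eventually_ne_atTop 0] with n hn
  exact div_mul_cancel₀ _ (Nat.cast_ne_zero.2 hn)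

end

end Iid

/-! ### The random proportions -/

section UniformIid

variable {Ω : Type*} [MeasurableSpace Ω] {P : Measure Ω}

lemma integrable_sub_log_of_uniform [IsFiniteMeasure P] {U : Ω → ℝ}
    (hU : MeasurePreserving U P (volume.restrict (Icc 0 1))) (s : ℝ) :
    Integrable (fun ω => s - Real.log (U ω)) P :=
  (integrable_const s).sub (integrable_log_of_uniform hU)

lemma integral_sub_log_of_uniform [IsProbabilityMeasure P] {U : Ω → ℝ}
    (hU : MeasurePreserving U P (volume.restrict (Icc 0 1))) (s : ℝ) :
    ∫ ω, (s - Real.log (U ω)) ∂P = s + 1 := by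
  rw [integral_sub (integrable_const s) (integrable_log_of_uniform hU),
    integral_log_of_uniform hU, integral_const, probReal_univ, one_smul, sub_neg_eq_add]

variable {U : ℕ → Ω → ℝ} {s : ℝ}

lemma identDistrib_sub_log_of_uniform
    (hU : ∀ n, MeasurePreserving (U n) P (volume.restrict (Icc 0 1))) (s : ℝ) (m n : ℕ) :
    IdentDistrib (fun ω => s - Real.log (U m ω)) (fun ω => s - Real.log (U n ω)) P P :=
  IdentDistrib.comp (u := fun x => s - Real.log x)
    ⟨(hU m).measurable.aemeasurable, (hU n).measurable.aemeasurable,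
      (hU m).map_eq.trans (hU n).map_eq.symm⟩ (by fun_prop)

lemma iIndepFun_sub_log (hindep : iIndepFun U P) (s : ℝ) :
    iIndepFun (fun n ω => s - Real.log (U n ω)) P :=
  hindep.comp (fun _ x => s - Real.log x) fun _ => by fun_prop

lemma ae_eventually_sum_sub_log_neg [IsProbabilityMeasure P]
    (hU : ∀ n, MeasurePreserving (U n) P (volume.restrict (Icc 0 1))) (hindep : iIndepFun U P)
    (hs : s < -1) :
    ∃ A ≥ 0, ∀ᵐ ω ∂P, ∀ᶠ n : ℕ in atTop, ∀ k : ℕ, A * Real.log (n + 1) ≤ k →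
      ∑ i ∈ Finset.range k, (s - Real.log (U (n + i) ω)) < 0 :=
  ae_eventually_sum_neg_of_integral_neg (X := fun n ω => s - Real.log (U n ω))
    (fun n => (hU n).measurable.log.const_sub s) (iIndepFun_sub_log hindep s)
    (fun n => identDistrib_sub_log_of_uniform hU s n 0)
    (zero_mem_interior_integrableExpSet_sub_log (hU 0) s)
    (by rw [integral_sub_log_of_uniform (hU 0)]; linarith)

lemma ae_tendsto_sum_sub_log_atTop [IsProbabilityMeasure P]
    (hU : ∀ n, MeasurePreserving (U n) P (volume.restrict (Icc 0 1))) (hindep : iIndepFun U P)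
    (hs : -1 < s) :
    ∀ᵐ ω ∂P, Tendsto (fun n => ∑ i ∈ Finset.range n, (s - Real.log (U i ω))) atTop atTop :=
  ae_tendsto_sum_atTop_of_integral_pos (X := fun n ω => s - Real.log (U n ω))
    (integrable_sub_log_of_uniform (hU 0) s) (iIndepFun_sub_log hindep s)
    (fun n => identDistrib_sub_log_of_uniform hU s n 0)
    (by rw [integral_sub_log_of_uniform (hU 0)]; linarith)

end UniformIid

section RandomProducts

variable {a b d : ℝ}

lemma log_maxBranch_eq_sub_log_skewTent (ha : 0 < a) (hb : 0 < b) {x : ℝ} (hx : x ∈ Ioo (0 : ℝ) 1)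
    (d : ℝ) :
    Real.log (maxBranch a b d x) =
      Real.log (a ^ d + b ^ d) - Real.log (skewTent (a ^ d / (a ^ d + b ^ d)) x) := by
  have hmax := maxBranch_eq_div_skewTent ha hb hx d
  have hne := div_ne_zero_iff.1 (hmax ▸ (maxBranch_pos ha hx.1).ne')
  rw [hmax, Real.log_div hne.1 hne.2]

lemma prod_maxBranch_eq_exp_sum (ha : 0 < a) (hb : 0 < b) {ι : Type*} {x : ι → ℝ}
    (hx : ∀ i, x i ∈ Ioo (0 : ℝ) 1) (d : ℝ) (s : Finset ι) :
    ∏ i ∈ s, maxBranch a b d (x i) = Real.exp (∑ i ∈ s, (Real.log (a ^ d + b ^ d) -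
      Real.log (skewTent (a ^ d / (a ^ d + b ^ d)) (x i)))) := by
  rw [Real.exp_sum]
  refine Finset.prod_congr rfl fun i _ => ?_
  rw [← log_maxBranch_eq_sub_log_skewTent ha hb (hx i), Real.exp_log (maxBranch_pos ha (hx i).1)]

lemma rpow_div_rpow_add_rpow_mem_Ioo (ha : 0 < a) (hb : 0 < b) (d : ℝ) :
    a ^ d / (a ^ d + b ^ d) ∈ Ioo (0 : ℝ) 1 :=
  ⟨by positivity, (div_lt_one (by positivity)).2
    (lt_add_of_pos_right _ (Real.rpow_pos_of_pos hb d))⟩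

variable {Ω : Type*} [MeasurableSpace Ω] {P : Measure Ω} [IsProbabilityMeasure P] {U : ℕ → Ω → ℝ}

lemma ae_eventually_prod_maxBranch_le_one
    (hU : ∀ n, MeasurePreserving (U n) P (volume.restrict (Icc 0 1))) (hindep : iIndepFun U P)
    (ha : 0 < a) (hb : 0 < b) (hd : a ^ d + b ^ d < Real.exp (-1)) :
    ∃ A ≥ 0, ∀ᵐ ω ∂P, ∀ᶠ n : ℕ in atTop, ∀ k : ℕ, A * Real.log (n + 1) ≤ k →
      ∏ i ∈ Finset.range k, maxBranch a b d (U (n + i) ω) ≤ 1 := by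
  have hS : 0 < a ^ d + b ^ d := by positivity
  have hq := rpow_div_rpow_add_rpow_mem_Ioo ha hb d
  obtain ⟨A, hA, hae⟩ := ae_eventually_sum_sub_log_neg
    (fun n => (measurePreserving_skewTent hq).comp (hU n))
    (hindep.comp (fun _ => skewTent _) fun _ => measurable_skewTent _)
    ((Real.log_lt_iff_lt_exp hS).2 hd)
  refine ⟨A, hA, ?_⟩
  filter_upwards [hae, ae_all_iff.2 fun n => ae_mem_Ioo_of_uniform (hU n)] with ω hω hmem
  filter_upwards [hω] with n hn k hk
  rw [prod_maxBranch_eq_exp_sum ha hb fun i => hmem (n + i)]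
  exact Real.exp_le_one_iff.2 (hn k hk).le

lemma ae_tendsto_prod_maxBranch_atTop
    (hU : ∀ n, MeasurePreserving (U n) P (volume.restrict (Icc 0 1))) (hindep : iIndepFun U P)
    (ha : 0 < a) (hb : 0 < b) (hd : Real.exp (-1) < a ^ d + b ^ d) :
    ∀ᵐ ω ∂P, Tendsto (fun n => ∏ i ∈ Finset.range n, maxBranch a b d (U i ω)) atTop atTop := by
  have hS : 0 < a ^ d + b ^ d := by positivity
  have hq := rpow_div_rpow_add_rpow_mem_Ioo ha hb d
  filter_upwards [ae_tendsto_sum_sub_log_atTop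
    (fun n => (measurePreserving_skewTent hq).comp (hU n))
    (hindep.comp (fun _ => skewTent _) fun _ => measurable_skewTent _)
    ((Real.lt_log_iff_exp_lt hS).2 hd),
    ae_all_iff.2 fun n => ae_mem_Ioo_of_uniform (hU n)] with ω hω hmem
  simp only [prod_maxBranch_eq_exp_sum ha hb hmem]
  exact Real.tendsto_exp_atTop.comp hω

end RandomProducts

/-! ### The function `G` -/

section BranchG

variable {a b : ℝ}

lemma branchLogProb_eq_mul_sub_log_maxBranch (ha : 0 < a) (hb : 0 < b) {x : ℝ}
    (hx : x ∈ Ioo (0 : ℝ) 1) (θ : ℝ) :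
    branchLogProb a b x θ = θ * branchLogRatio a b x θ - Real.log (maxBranch a b θ x) := by
  have hA := Real.rpow_pos_of_pos ha θ
  have hB := Real.rpow_pos_of_pos hb θ
  have hx' : 0 < 1 - x := sub_pos.2 hx.2
  have hle : x ≤ a ^ θ / (a ^ θ + b ^ θ) ↔ b ^ θ / (1 - x) ≤ a ^ θ / x := by
    rw [le_div_iff₀ (add_pos hA hB), div_le_div_iff₀ hx' hx.1]
    constructor <;> intro h <;> linarith
  by_cases h : x ≤ a ^ θ / (a ^ θ + b ^ θ)
  · rw [branchLogProb, branchLogRatio, if_pos h, if_pos h, maxBranch, max_eq_left (hle.1 h),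
      Real.log_div hA.ne' hx.1.ne', Real.log_rpow ha, sub_sub_cancel]
  · rw [branchLogProb, branchLogRatio, if_neg h, if_neg h, maxBranch,
      max_eq_right (le_of_not_ge (mt hle.2 h)), Real.log_div hB.ne' hx'.ne', Real.log_rpow hb,
      sub_sub_cancel]

variable {Ω : Type*} [MeasurableSpace Ω] {P : Measure Ω} {U : Ω → ℝ}

lemma ae_branchLogProb_eq (hU : MeasurePreserving U P (volume.restrict (Icc 0 1))) (ha : 0 < a)
    (hb : 0 < b) (θ : ℝ) :
    (fun ω => branchLogProb a b (U ω) θ) =ᵐ[P] fun ω => θ * branchLogRatio a b (U ω) θ -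
      (Real.log (a ^ θ + b ^ θ) - Real.log (skewTent (a ^ θ / (a ^ θ + b ^ θ)) (U ω))) := by
  filter_upwards [ae_mem_Ioo_of_uniform hU] with ω hω
  rw [branchLogProb_eq_mul_sub_log_maxBranch ha hb hω, log_maxBranch_eq_sub_log_skewTent ha hb hω]

lemma integrable_branchLogRatio [IsFiniteMeasure P] (hU : Measurable U) (a b θ : ℝ) :
    Integrable (fun ω => branchLogRatio a b (U ω) θ) P :=
  integrable_ite_le hU _ _ _

variable [IsProbabilityMeasure P]

lemma integral_branchLogRatio (hU : MeasurePreserving U P (volume.restrict (Icc 0 1)))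
    (ha : 0 < a) (hb : 0 < b) (θ : ℝ) :
    ∫ ω, branchLogRatio a b (U ω) θ ∂P =
      (a ^ θ * Real.log a + b ^ θ * Real.log b) / (a ^ θ + b ^ θ) := by
  have hS : a ^ θ + b ^ θ ≠ 0 := by positivity
  have hq := Ioo_subset_Icc_self (rpow_div_rpow_add_rpow_mem_Ioo ha hb θ)
  refine (integral_ite_le_of_uniform hU hq (Real.log a) (Real.log b)).trans ?_
  rw [one_sub_div hS, add_sub_cancel_left, div_mul_eq_mul_div, div_mul_eq_mul_div, ← add_div]

lemma integrable_branchLogProb (hU : MeasurePreserving U P (volume.restrict (Icc 0 1)))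
    (ha : 0 < a) (hb : 0 < b) (θ : ℝ) : Integrable (fun ω => branchLogProb a b (U ω) θ) P := by
  have hV := (measurePreserving_skewTent (rpow_div_rpow_add_rpow_mem_Ioo ha hb θ)).comp hU
  exact (((integrable_branchLogRatio hU.measurable a b θ).const_mul θ).sub
    (integrable_sub_log_of_uniform hV _)).congr (ae_branchLogProb_eq hU ha hb θ).symm

lemma integral_branchLogProb (hU : MeasurePreserving U P (volume.restrict (Icc 0 1)))
    (ha : 0 < a) (hb : 0 < b) (θ : ℝ) :
    ∫ ω, branchLogProb a b (U ω) θ ∂P =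
      θ * ∫ ω, branchLogRatio a b (U ω) θ ∂P - (Real.log (a ^ θ + b ^ θ) + 1) := by
  have hV : MeasurePreserving (fun ω => skewTent (a ^ θ / (a ^ θ + b ^ θ)) (U ω)) P
      (volume.restrict (Icc 0 1)) :=
    (measurePreserving_skewTent (rpow_div_rpow_add_rpow_mem_Ioo ha hb θ)).comp hU
  rw [integral_congr_ae (ae_branchLogProb_eq hU ha hb θ),
    integral_sub ((integrable_branchLogRatio hU.measurable a b θ).const_mul θ)
      (integrable_sub_log_of_uniform hV _), integral_const_mul, integral_sub_log_of_uniform hV]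

lemma branchG_eq (hU : MeasurePreserving U P (volume.restrict (Icc 0 1))) (ha : 0 < a)
    (hb : 0 < b) (θ : ℝ) :
    branchG P (fun _ => a) (fun _ => b) U θ =
      (a ^ θ * Real.log (a ^ θ / (a ^ θ + b ^ θ)) - a ^ θ
          + b ^ θ * Real.log (b ^ θ / (a ^ θ + b ^ θ)) - b ^ θ) /
        (a ^ θ * Real.log a + b ^ θ * Real.log b) := by
  have hA := Real.rpow_pos_of_pos ha θ
  have hB := Real.rpow_pos_of_pos hb θ
  have hS := add_pos hA hB
  rw [branchG, integral_branchLogProb hU ha hb, integral_branchLogRatio hU ha hb,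
    Real.log_div hA.ne' hS.ne', Real.log_div hB.ne' hS.ne', Real.log_rpow ha, Real.log_rpow hb,
    ← mul_div_mul_left _ _ hS.ne', mul_div_cancel₀ _ hS.ne']
  congr 1
  field_simp
  ring

lemma branchG_eq_self_iff (hU : MeasurePreserving U P (volume.restrict (Icc 0 1)))
    (ha : a ∈ Ioo (0 : ℝ) 1) (hb : b ∈ Ioo (0 : ℝ) 1) (θ : ℝ) :
    branchG P (fun _ => a) (fun _ => b) U θ = θ ↔ a ^ θ + b ^ θ = Real.exp (-1) := by
  have hA := Real.rpow_pos_of_pos ha.1 θ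
  have hB := Real.rpow_pos_of_pos hb.1 θ
  have hZ : ∫ ω, branchLogRatio a b (U ω) θ ∂P < 0 := by
    rw [integral_branchLogRatio hU ha.1 hb.1]
    exact div_neg_of_neg_of_pos (add_neg (mul_neg_of_pos_of_neg hA (Real.log_neg ha.1 ha.2))
      (mul_neg_of_pos_of_neg hB (Real.log_neg hb.1 hb.2))) (add_pos hA hB)
  rw [branchG, integral_branchLogProb hU ha.1 hb.1, div_eq_iff hZ.ne, sub_eq_self,
    add_eq_zero_iff_eq_neg, ← Real.exp_eq_exp, Real.exp_log (add_pos hA hB)]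

end BranchG

/-! ### The almost sure dimension -/

/-- The number `D_{ab}` of the paper: the root of `a ^ θ + b ^ θ = e⁻¹`, which exists and is unique
when `a` and `b` lie in `(0, 1)`. The value for other `a`, `b` is irrelevant. -/
noncomputable def moranDim (a b : ℝ) : ℝ :=
  Classical.epsilon fun θ : ℝ => a ^ θ + b ^ θ = Real.exp (-1)

lemma moranDim_comm (a b : ℝ) : moranDim a b = moranDim b a := by
  simp only [moranDim, add_comm]

lemma strictAnti_rpow_add_rpow {a b : ℝ} (ha : a ∈ Ioo (0 : ℝ) 1) (hb : b ∈ Ioo (0 : ℝ) 1) :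
    StrictAnti fun θ : ℝ => a ^ θ + b ^ θ :=
  (Real.strictAnti_rpow_of_base_lt_one ha.1 ha.2).add
    (Real.strictAnti_rpow_of_base_lt_one hb.1 hb.2)

lemma exists_rpow_add_rpow_eq {a b y : ℝ} (ha : a ∈ Ioo (0 : ℝ) 1) (hb : b ∈ Ioo (0 : ℝ) 1)
    (hy : 0 < y) : ∃ θ : ℝ, a ^ θ + b ^ θ = y := by
  have hcont : Continuous fun θ : ℝ => a ^ θ + b ^ θ :=
    (Real.continuous_const_rpow ha.1.ne').add (Real.continuous_const_rpow hb.1.ne')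
  have hbot : Tendsto (fun θ : ℝ => a ^ θ + b ^ θ) atBot atTop :=
    (tendsto_rpow_atBot_of_base_lt_one a ha.1 ha.2).atTop_add_nonneg
      fun θ => Real.rpow_nonneg hb.1.le θ
  have htop : Tendsto (fun θ : ℝ => a ^ θ + b ^ θ) atTop (𝓝 0) := by
    simpa only [add_zero] using
      (tendsto_rpow_atTop_of_base_lt_one a (by linarith [ha.1]) ha.2).add
        (tendsto_rpow_atTop_of_base_lt_one b (by linarith [hb.1]) hb.2)
  exact mem_range_of_exists_le_of_exists_ge hcont
    (htop.eventually_le_const hy).exists (hbot.eventually_ge_atTop y).exists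

section MoranDim

variable {a b : ℝ}

lemma rpow_moranDim_add_rpow_moranDim (ha : a ∈ Ioo (0 : ℝ) 1) (hb : b ∈ Ioo (0 : ℝ) 1) :
    a ^ moranDim a b + b ^ moranDim a b = Real.exp (-1) :=
  Classical.epsilon_spec (exists_rpow_add_rpow_eq ha hb (Real.exp_pos (-1)))

lemma rpow_add_rpow_eq_exp_iff (ha : a ∈ Ioo (0 : ℝ) 1) (hb : b ∈ Ioo (0 : ℝ) 1) {θ : ℝ} :
    a ^ θ + b ^ θ = Real.exp (-1) ↔ θ = moranDim a b := by
  rw [← rpow_moranDim_add_rpow_moranDim ha hb]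
  exact (strictAnti_rpow_add_rpow ha hb).injective.eq_iff

lemma rpow_add_rpow_lt_exp_iff (ha : a ∈ Ioo (0 : ℝ) 1) (hb : b ∈ Ioo (0 : ℝ) 1) {θ : ℝ} :
    a ^ θ + b ^ θ < Real.exp (-1) ↔ moranDim a b < θ := by
  rw [← rpow_moranDim_add_rpow_moranDim ha hb]
  exact (strictAnti_rpow_add_rpow ha hb).lt_iff_gt

lemma exp_lt_rpow_add_rpow_iff (ha : a ∈ Ioo (0 : ℝ) 1) (hb : b ∈ Ioo (0 : ℝ) 1) {θ : ℝ} :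
    Real.exp (-1) < a ^ θ + b ^ θ ↔ θ < moranDim a b := by
  rw [← rpow_moranDim_add_rpow_moranDim ha hb]
  exact (strictAnti_rpow_add_rpow ha hb).lt_iff_gt

lemma moranDim_pos (ha : a ∈ Ioo (0 : ℝ) 1) (hb : b ∈ Ioo (0 : ℝ) 1) : 0 < moranDim a b := by
  rw [← exp_lt_rpow_add_rpow_iff ha hb, Real.rpow_zero, Real.rpow_zero]
  exact (Real.exp_lt_one_iff.2 neg_one_lt_zero).trans (by norm_num)

end MoranDim

section Limits

variable {ι : Type*} {l : Filter ι} {a b : ι → ℝ}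

lemma tendsto_moranDim_zero (hmem : ∀ᶠ i in l, a i ∈ Ioo (0 : ℝ) 1 ∧ b i ∈ Ioo (0 : ℝ) 1)
    (ha : Tendsto a l (𝓝 0)) (hb : Tendsto b l (𝓝 0)) :
    Tendsto (fun i => moranDim (a i) (b i)) l (𝓝 0) := by
  refine tendsto_order.2 ⟨fun ε hε => ?_, fun ε hε => ?_⟩
  · filter_upwards [hmem] with i hi
    exact hε.trans (moranDim_pos hi.1 hi.2)
  · have hlim : Tendsto (fun i => a i ^ ε + b i ^ ε) l (𝓝 0) := by
      simpa only [Real.zero_rpow hε.ne', add_zero] using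
        (ha.rpow_const (Or.inr hε.le)).add (hb.rpow_const (Or.inr hε.le))
    filter_upwards [hmem, hlim.eventually_lt_const (Real.exp_pos (-1))] with i hi hlt
    exact (rpow_add_rpow_lt_exp_iff hi.1 hi.2).1 hlt

lemma tendsto_moranDim_atTop (hmem : ∀ᶠ i in l, a i ∈ Ioo (0 : ℝ) 1 ∧ b i ∈ Ioo (0 : ℝ) 1)
    (ha : Tendsto a l (𝓝 1)) : Tendsto (fun i => moranDim (a i) (b i)) l atTop := by
  refine tendsto_atTop.2 fun M => ?_
  have hlim : Tendsto (fun i => a i ^ M) l (𝓝 1) := by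
    simpa only [Real.one_rpow] using ha.rpow_const (Or.inl one_ne_zero)
  filter_upwards [hmem, hlim.eventually_const_lt (Real.exp_lt_one_iff.2 neg_one_lt_zero)]
    with i hi hlt
  exact ((exp_lt_rpow_add_rpow_iff hi.1 hi.2).1
    (hlt.trans (lt_add_of_pos_right _ (Real.rpow_pos_of_pos hi.2.1 M)))).le

end Limits

lemma mem_Ioo_of_add_lt_one {a b : ℝ} (h : 0 < a ∧ 0 < b ∧ a + b < 1) :
    a ∈ Ioo (0 : ℝ) 1 ∧ b ∈ Ioo (0 : ℝ) 1 :=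
  ⟨⟨h.1, by linarith⟩, h.2.1, by linarith⟩

lemma moranRatioBounds_const {a b : ℝ} (ha : 0 < a) (hb : 0 < b) (hab : a + b < 1) :
    MoranRatioBounds (fun _ => a) (fun _ => b) (min a b) (1 - a - b) where
  pos := lt_min ha hb
  gap_pos := by linarith
  le_left _ := min_le_left a b
  le_right _ := min_le_right a b
  add_add_le_one _ := by linarith

lemma ae_upperPhiDim_moranMeasure_eq {Ω : Type*} [MeasurableSpace Ω] {P : Measure Ω}
    [IsProbabilityMeasure P] {p : ℕ → Ω → unitInterval}
    (hp : ∀ n, MeasurePreserving (fun ω => (p n ω : ℝ)) P (volume.restrict (Icc 0 1)))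
    (hindep : iIndepFun p P) {a b : ℝ} (ha : 0 < a) (hb : 0 < b) (hab : a + b < 1) :
    ∀ᵐ ω ∂P, ∀ Φ : ℝ → ℝ, IsLargeDimensionFunction Φ →
      upperPhiDim Φ (moranMeasure (fun _ => a) (fun _ => b) (fun n => p n ω)) = moranDim a b := by
  obtain ⟨ha₁, hb₁⟩ := mem_Ioo_of_add_lt_one ⟨ha, hb, hab⟩
  have hbounds := moranRatioBounds_const ha hb hab
  have hindep' : iIndepFun (fun n ω => (p n ω : ℝ)) P :=
    hindep.comp (fun _ => Subtype.val) fun _ => measurable_subtype_coe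
  obtain ⟨u, -, hu, hu_lim⟩ := exists_seq_strictAnti_tendsto (moranDim a b)
  obtain ⟨l, -, hl, hl_lim⟩ := exists_seq_strictMono_tendsto (moranDim a b)
  choose A hA hupper using fun k => ae_eventually_prod_maxBranch_le_one hp hindep' ha hb
    ((rpow_add_rpow_lt_exp_iff ha₁ hb₁).2 (hu k))
  have hlower := fun k => ae_tendsto_prod_maxBranch_atTop hp hindep' ha hb
    ((exp_lt_rpow_add_rpow_iff ha₁ hb₁).2 (hl k))
  filter_upwards [ae_all_iff.2 hupper, ae_all_iff.2 hlower,
    ae_all_iff.2 fun n => ae_mem_Ioo_of_uniform (hp n)] with ω hω_upper hω_lower hω Φ hΦ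
  have hu_coe := (continuous_coe_real_ereal.tendsto _).comp hu_lim
  have hl_coe := (continuous_coe_real_ereal.tendsto _).comp hl_lim
  refine le_antisymm (ge_of_tendsto' hu_coe fun k => ?_) (le_of_tendsto' hl_coe fun k => ?_)
  · exact hbounds.upperPhiDim_moranMeasure_le hω ((moranDim_pos ha₁ hb₁).trans (hu k)).le (hA k)
      (hω_upper k) hΦ
  · exact hbounds.le_upperPhiDim_moranMeasure hω (hω_lower k) hΦ.1.1

theorem mainTheorem10 {Ω : Type*} [MeasurableSpace Ω] (P : Measure Ω) [IsProbabilityMeasure P]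
    (p : ℕ → Ω → unitInterval) (hp : ∀ n, Measurable (p n))
    (hunif : ∀ n, pdf.IsUniform (fun ω => (p n ω : ℝ)) (Icc (0 : ℝ) 1) P)
    (hindep : iIndepFun p P) :
    (∀ a b : ℝ, 0 < a → 0 < b → a + b < 1 → ∀ θ : ℝ, 0 ≤ θ →
      Integrable (fun ω => branchLogProb a b (p 0 ω) θ) P ∧
      Integrable (fun ω => branchLogRatio a b (p 0 ω) θ) P ∧
      branchG P (fun _ => a) (fun _ => b) (fun ω => p 0 ω) θ =
        (a ^ θ * Real.log (a ^ θ / (a ^ θ + b ^ θ)) - a ^ θ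
            + b ^ θ * Real.log (b ^ θ / (a ^ θ + b ^ θ)) - b ^ θ) /
          (a ^ θ * Real.log a + b ^ θ * Real.log b)) ∧
    ∃ D : ℝ → ℝ → ℝ,
      (∀ a b γ : ℝ, 0 < a → 0 < b → a + b < 1 → a = b ^ γ →
        (∀ θ : ℝ, 0 ≤ θ →
          (branchG P (fun _ => a) (fun _ => b) (fun ω => p 0 ω) θ = θ ↔
            b ^ θ + b ^ (γ * θ) = Real.exp (-1))) ∧
        (∀ θ : ℝ, b ^ θ + b ^ (γ * θ) = Real.exp (-1) ↔ θ = D a b) ∧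
        0 < D a b ∧
        ∀ᵐ ω ∂P, ∀ Φ : ℝ → ℝ, IsLargeDimensionFunction Φ →
          upperPhiDim Φ (moranMeasure (fun _ => a) (fun _ => b) (fun n => p n ω)) = D a b) ∧
      Tendsto (fun q : ℝ × ℝ => D q.1 q.2)
        (𝓝[{q : ℝ × ℝ | 0 < q.1 ∧ 0 < q.2 ∧ q.1 + q.2 < 1}] (0, 0)) (𝓝 0) ∧
      Tendsto (fun q : ℝ × ℝ => D q.1 q.2)
        (comap Prod.fst (𝓝 1) ⊓ 𝓟 {q : ℝ × ℝ | 0 < q.1 ∧ 0 < q.2 ∧ q.1 + q.2 < 1}) atTop ∧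
      Tendsto (fun q : ℝ × ℝ => D q.1 q.2)
        (comap Prod.snd (𝓝 1) ⊓ 𝓟 {q : ℝ × ℝ | 0 < q.1 ∧ 0 < q.2 ∧ q.1 + q.2 < 1}) atTop := by
  have hU := fun n => measurePreserving_of_isUniform (hp n).subtype_val (hunif n) (by simp)
  refine ⟨fun a b ha hb _ θ _ => ⟨integrable_branchLogProb (hU 0) ha hb θ,
    integrable_branchLogRatio (hU 0).measurable a b θ, branchG_eq (hU 0) ha hb θ⟩,
    moranDim, fun a b γ ha hb hab hγ => ?_, ?_, ?_, ?_⟩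
  · have hpow : ∀ θ : ℝ, b ^ θ + b ^ (γ * θ) = a ^ θ + b ^ θ := fun θ => by
      rw [Real.rpow_mul hb.le, ← hγ, add_comm]
    obtain ⟨ha₁, hb₁⟩ := mem_Ioo_of_add_lt_one ⟨ha, hb, hab⟩
    simp only [hpow]
    exact ⟨fun θ _ => branchG_eq_self_iff (hU 0) ha₁ hb₁ θ,
      fun θ => rpow_add_rpow_eq_exp_iff ha₁ hb₁, moranDim_pos ha₁ hb₁,
      ae_upperPhiDim_moranMeasure_eq hU hindep ha hb hab⟩
  · exact tendsto_moranDim_zero (eventually_mem_nhdsWithin.mono fun _ => mem_Ioo_of_add_lt_one)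
      ((continuous_fst.tendsto (0, 0)).mono_left nhdsWithin_le_nhds)
      ((continuous_snd.tendsto (0, 0)).mono_left nhdsWithin_le_nhds)
  · exact tendsto_moranDim_atTop
      (eventually_inf_principal.2 (.of_forall fun _ => mem_Ioo_of_add_lt_one))
      (tendsto_comap.mono_left inf_le_left)
  · exact (tendsto_moranDim_atTop
      (eventually_inf_principal.2 (.of_forall fun _ hq => (mem_Ioo_of_add_lt_one hq).symm))
      (tendsto_comap.mono_left inf_le_left)).congr fun q => moranDim_comm q.2 q.1
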